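/- \textbf{Theorem (Green's formula: scalar-valued version).} Let $k\ge 0$, let $\mathcal{H}_k(\mathbb{R})$ be the space of real harmonic polynomials in $u\in\mathbb{R}^m$ that are homogeneous of degree $k$, and let $\Omega\subset\mathbb{R}^m$ be a bounded open set with $C^1$ boundary. Let $f,g\in C^2(\overline{\Omega}\times\mathbb{B}^m,\mathcal{H}_k(\mathbb{R}))$, that is, $f(x,\cdot),g(x,\cdot)\in\mathcal{H}_k(\mathbb{R})$ for every $x\in\overline\Omega$, and $f,g$ are twice continuously differentiable on $\overline\Omega\times\mathbb{B}^m$, up to the boundary of $\Omega$ in $x$ (here $\mathbb{B}^m$ is the open unit ball). With $$\langle u,D_x\rangle=\sum_{j=1}^m u_j\partial_{x_j},\qquad \langle D_u,D_x\rangle=\sum_{j=1}^m\partial_{u_j}\partial_{x_j},$$ put $$\mathcal{D}_k=\Delta_x-\frac{4\langle u,D_x\rangle\langle D_u,D_x\rangle}{m+2k-2}+\frac{4|u|^2\langle D_u,D_x\rangle^2}{(m+2k-2)(m+2k-4)},\qquad A=\frac{\partial}{\partial n_x}-\frac{4\langle u,n_x\rangle\langle D_u,D_x\rangle}{m+2k-2},$$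 where $n_x$ is the outward unit normal at $x\in\partial\Omega$ (a term whose denominator vanishes is read as $0$). Then $$\int_\Omega\int_{\mathbb{S}^{m-1}}\big[(\mathcal{D}_kf)(x,u)\,g(x,u)-f(x,u)\,(\mathcal{D}_kg)(x,u)\big]\,dS(u)\,dx=\int_{\partial\Omega}\int_{\mathbb{S}^{m-1}}\big[(Af)(x,u)\,g(x,u)-f(x,u)\,(Ag)(x,u)\big]\,dS(u)\,d\sigma(x),$$ where $dS$ and $d\sigma$ are the area elements on $\mathbb{S}^{m-1}$ and on $\partial\Omega$, and each of the four products is absolutely integrable. In particular, if $f$ and $g$ vanish on $\partial\Omega\times\mathbb{S}^{m-1}$, then $\langle\mathcal{D}_kf\,|\,g\rangle=\langle f\,|\,\mathcal{D}_kg\rangle$ for the pairing $\langle f\,|\,g\rangle=\int_\Omega\int_{\mathbb{S}^{m-1}}f(x,u)g(x,u)\,dS(u)\,dx$; that is, $\mathcal{D}_k$ is self-adjoint (symmetric) for this pairing on functions vanishing on the boundary. -/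

import Mathlib

open MeasureTheory Filter Metric
open scoped Topology InnerProductSpace

noncomputable section

/-- The space `ℋ_k(ℝ)` of real harmonic polynomials in `m` variables, homogeneous of degree `k`. -/
def harmonicPolynomials (m k : ℕ) : Set (MvPolynomial (Fin m) ℝ) :=
  {p | p.IsHomogeneous k ∧ ∑ i, MvPolynomial.pderiv i (MvPolynomial.pderiv i p) = 0}

/-- `f ∈ C²(Ω̄ × 𝔹^m, ℋ_k(ℝ))`: for every `x ∈ Ω̄` the function `u ↦ f x u` is (evaluation of) an
element of `ℋ_k(ℝ)`, and `f` is twice continuously differentiable in `(x, u)`, up to `∂Ω` in `x`.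
The values of `f x` for `x ∉ Ω̄` play no role. -/
structure IsC2Harmonic {m : ℕ} (Ω : Set (EuclideanSpace ℝ (Fin m))) (k : ℕ)
    (f : EuclideanSpace ℝ (Fin m) → EuclideanSpace ℝ (Fin m) → ℝ) : Prop where
  harmonic : ∀ x ∈ closure Ω, ∃ p ∈ harmonicPolynomials m k,
    ∀ u : EuclideanSpace ℝ (Fin m), f x u = MvPolynomial.eval (fun i => u i) p
  contDiffOn : ContDiffOn ℝ 2
    (fun z : EuclideanSpace ℝ (Fin m) × EuclideanSpace ℝ (Fin m) => f z.1 z.2)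
    (closure Ω ×ˢ ball 0 1)

/-- `Ω` has `C¹` boundary: near each boundary point, for a suitable unit vector `e`, the set `Ω` is
the part below the graph of a `C¹` function over the hyperplane `e^⊥`
(`y - ⟪e, y⟫ e` is the orthogonal projection of `y` to that hyperplane). -/
def HasC1Boundary {m : ℕ} (Ω : Set (EuclideanSpace ℝ (Fin m))) : Prop :=
  ∀ x ∈ frontier Ω, ∃ U : Set (EuclideanSpace ℝ (Fin m)), IsOpen U ∧ x ∈ U ∧
    ∃ (e : EuclideanSpace ℝ (Fin m)) (φ : EuclideanSpace ℝ (Fin m) → ℝ),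
      ‖e‖ = 1 ∧ ContDiff ℝ 1 φ ∧
      ∀ y ∈ U, (y ∈ Ω ↔ ⟪e, y⟫_ℝ < φ (y - ⟪e, y⟫_ℝ • e))

/-- `n` is the outward unit normal to `Ω` at the boundary point `x`: directions with `⟪v, n⟫ < 0`
point into `Ω`, and directions with `⟪v, n⟫ > 0` point out of the closure of `Ω`. -/
def IsOutwardUnitNormal {m : ℕ} (Ω : Set (EuclideanSpace ℝ (Fin m)))
    (x n : EuclideanSpace ℝ (Fin m)) : Prop :=
  ‖n‖ = 1 ∧
  (∀ v : EuclideanSpace ℝ (Fin m), ⟪v, n⟫_ℝ < 0 → ∀ᶠ t : ℝ in 𝓝[>] 0, x + t • v ∈ Ω) ∧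
  (∀ v : EuclideanSpace ℝ (Fin m), 0 < ⟪v, n⟫_ℝ → ∀ᶠ t : ℝ in 𝓝[>] 0, x + t • v ∉ closure Ω)

/-- There is at most one outward unit normal at a point. -/
theorem IsOutwardUnitNormal.unique {m : ℕ} {Ω : Set (EuclideanSpace ℝ (Fin m))}
    {x n n' : EuclideanSpace ℝ (Fin m)} (h : IsOutwardUnitNormal Ω x n)
    (h' : IsOutwardUnitNormal Ω x n') : n = n' := by
  by_contra hne
  have hlt : ⟪n, n'⟫_ℝ < 1 := by
    rcases lt_or_eq_of_le (real_inner_le_norm n n') with hl | he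
    · rwa [h.1, h'.1, one_mul] at hl
    · have := inner_eq_norm_mul_iff_real.1 he
      rw [h.1, h'.1, one_smul, one_smul] at this
      exact absurd this hne
  have e1 : ⟪n' - n, n⟫_ℝ < 0 := by
    rw [inner_sub_left, real_inner_self_eq_norm_sq, h.1, real_inner_comm]
    linarith
  have e2 : 0 < ⟪n' - n, n'⟫_ℝ := by
    rw [inner_sub_left, real_inner_self_eq_norm_sq, h'.1]
    linarith
  obtain ⟨t, ht, ht'⟩ := ((h.2.1 _ e1).and (h'.2.2 _ e2)).exists
  exact ht' (subset_closure ht)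

open Classical in
/-- The outward unit normal `n_x` at `x ∈ ∂Ω` (it is `0` where there is none). -/
def outwardUnitNormal {m : ℕ} (Ω : Set (EuclideanSpace ℝ (Fin m)))
    (x : EuclideanSpace ℝ (Fin m)) : EuclideanSpace ℝ (Fin m) :=
  if h : ∃ n, IsOutwardUnitNormal Ω x n then h.choose else 0

theorem IsOutwardUnitNormal.outwardUnitNormal_eq {m : ℕ} {Ω : Set (EuclideanSpace ℝ (Fin m))}
    {x n : EuclideanSpace ℝ (Fin m)} (h : IsOutwardUnitNormal Ω x n) :
    outwardUnitNormal Ω x = n := by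
  have hex : ∃ n, IsOutwardUnitNormal Ω x n := ⟨n, h⟩
  rw [outwardUnitNormal, dif_pos hex]
  exact hex.choose_spec.unique h

/-- `∂f/∂v` in the variable `x`. At points of `Ω` this is the ordinary directional derivative, at
points of `∂Ω` it is the one-sided derivative, from within `Ω̄`. -/
def derivX {m : ℕ} (Ω : Set (EuclideanSpace ℝ (Fin m))) (v : EuclideanSpace ℝ (Fin m))
    (f : EuclideanSpace ℝ (Fin m) → EuclideanSpace ℝ (Fin m) → ℝ) :
    EuclideanSpace ℝ (Fin m) → EuclideanSpace ℝ (Fin m) → ℝ :=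
  fun x u => fderivWithin ℝ (fun y => f y u) (closure Ω) x v

/-- `∂f/∂x_j`. -/
def partialX {m : ℕ} (Ω : Set (EuclideanSpace ℝ (Fin m))) (j : Fin m)
    (f : EuclideanSpace ℝ (Fin m) → EuclideanSpace ℝ (Fin m) → ℝ) :
    EuclideanSpace ℝ (Fin m) → EuclideanSpace ℝ (Fin m) → ℝ :=
  derivX Ω (EuclideanSpace.single j 1) f

/-- `∂f/∂u_j`. -/
def partialU {m : ℕ} (j : Fin m)
    (f : EuclideanSpace ℝ (Fin m) → EuclideanSpace ℝ (Fin m) → ℝ) :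
    EuclideanSpace ℝ (Fin m) → EuclideanSpace ℝ (Fin m) → ℝ :=
  fun x u => fderiv ℝ (f x) u (EuclideanSpace.single j 1)

/-- The Laplacian `Δ_x = ∑ⱼ ∂²/∂x_j²`. -/
def laplacianX {m : ℕ} (Ω : Set (EuclideanSpace ℝ (Fin m)))
    (f : EuclideanSpace ℝ (Fin m) → EuclideanSpace ℝ (Fin m) → ℝ) :
    EuclideanSpace ℝ (Fin m) → EuclideanSpace ℝ (Fin m) → ℝ :=
  fun x u => ∑ j, partialX Ω j (partialX Ω j f) x u

/-- The operator `⟨D_u, D_x⟩ = ∑ⱼ ∂/∂u_j ∂/∂x_j`. -/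
def innerDuDx {m : ℕ} (Ω : Set (EuclideanSpace ℝ (Fin m)))
    (f : EuclideanSpace ℝ (Fin m) → EuclideanSpace ℝ (Fin m) → ℝ) :
    EuclideanSpace ℝ (Fin m) → EuclideanSpace ℝ (Fin m) → ℝ :=
  fun x u => ∑ j, partialU j (partialX Ω j f) x u

/-- The operator `⟨u, D_x⟩ = ∑ⱼ u_j ∂/∂x_j`. -/
def innerUDx {m : ℕ} (Ω : Set (EuclideanSpace ℝ (Fin m)))
    (f : EuclideanSpace ℝ (Fin m) → EuclideanSpace ℝ (Fin m) → ℝ) :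
    EuclideanSpace ℝ (Fin m) → EuclideanSpace ℝ (Fin m) → ℝ :=
  fun x u => ∑ j, u j * partialX Ω j f x u

/-- The bosonic Laplacian `𝒟_k`. -/
def bosonicLaplacian {m : ℕ} (Ω : Set (EuclideanSpace ℝ (Fin m))) (k : ℕ)
    (f : EuclideanSpace ℝ (Fin m) → EuclideanSpace ℝ (Fin m) → ℝ) :
    EuclideanSpace ℝ (Fin m) → EuclideanSpace ℝ (Fin m) → ℝ :=
  fun x u =>
    laplacianX Ω f x u
      - 4 * innerUDx Ω (innerDuDx Ω f) x u / ((m : ℝ) + 2 * k - 2)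
      + 4 * ‖u‖ ^ 2 * innerDuDx Ω (innerDuDx Ω f) x u /
          (((m : ℝ) + 2 * k - 2) * ((m : ℝ) + 2 * k - 4))

/-- The boundary operator `A = ∂/∂n_x - 4 ⟨u, n_x⟩ ⟨D_u, D_x⟩ / (m + 2k - 2)`. -/
def boundaryOperator {m : ℕ} (Ω : Set (EuclideanSpace ℝ (Fin m))) (k : ℕ)
    (f : EuclideanSpace ℝ (Fin m) → EuclideanSpace ℝ (Fin m) → ℝ) :
    EuclideanSpace ℝ (Fin m) → EuclideanSpace ℝ (Fin m) → ℝ :=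
  fun x u =>
    derivX Ω (outwardUnitNormal Ω x) f x u
      - 4 * ⟪u, outwardUnitNormal Ω x⟫_ℝ * innerDuDx Ω f x u / ((m : ℝ) + 2 * k - 2)

/-- The area measure `dS` on the unit sphere `S^{m-1}`. -/
def sphereArea (m : ℕ) : Measure (sphere (0 : EuclideanSpace ℝ (Fin m)) 1) :=
  (volume : Measure (EuclideanSpace ℝ (Fin m))).toSphere

/-- The area measure `dσ` on `∂Ω`: the `(m-1)`-dimensional Hausdorff measure, normalized to agree
with Lebesgue measure on hyperplanes. -/
def boundaryArea {m : ℕ} (Ω : Set (EuclideanSpace ℝ (Fin m))) :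
    Measure (EuclideanSpace ℝ (Fin m)) :=
  (μHE[m - 1]).restrict (frontier Ω)

/-- The `L²` pairing `⟨f | g⟩ = ∫_Ω ∫_{S^{m-1}} f g dS(u) dx`. -/
def pairing {m : ℕ} (Ω : Set (EuclideanSpace ℝ (Fin m)))
    (f g : EuclideanSpace ℝ (Fin m) → EuclideanSpace ℝ (Fin m) → ℝ) : ℝ :=
  ∫ x in Ω, ∫ u : sphere (0 : EuclideanSpace ℝ (Fin m)) 1, f x u * g x u ∂(sphereArea m)

end

/-!
Both sides of Green's formula reduce to integrals in `x` alone. Since `ℋ_k(ℝ)` is finite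
dimensional, `f x u = ∑ᵢ cᵢ(x) pᵢ(u)` with `pᵢ ∈ ℋ_k(ℝ)` and coefficients `cᵢ` that are `C²` on the
closure of `Ω` (`IsC2Harmonic.exists_separated`), and likewise `g x u = ∑ᵢ dᵢ(x) qᵢ(u)`. Integrate
over the sphere first. Harmonic polynomials of different degrees are orthogonal on the sphere
(`sphereIntegral_mul_eq_zero`), and so

* the term of `𝒟_k f` with `|u|²` contributes nothing, as `∂_l ∂_j pᵢ` has degree `k - 2`;
* in `∫ ∂_j p · u_l q dS` only the component of `u_l q` of degree `k - 1` counts, which is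
  `(m + 2k - 2)⁻¹ ∂_l q` on the sphere (`sphereIntegral_pderiv_mul_X_mul`).

Hence `∫ (𝒟_k f) g dS = ∑ B_{jl}(pᵢ, qᵢ') ∂_l ∂_j cᵢ · dᵢ'` and
`∫ (A f) g dS = ∑ B_{jl}(pᵢ, qᵢ') ∂_j cᵢ · dᵢ' n_l` with the same constants
`B_{jl}(p, q) = δ_{jl} ∫ p q dS - 4 (m + 2k - 2)⁻² ∫ ∂_j p ∂_l q dS` (`greenForm`). As
`B_{jl}(p, q) = B_{lj}(q, p)`, Green's formula is a linear combination of integrations by parts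
(`HasC1Boundary.integral_coordDeriv_mul_sub`), which follow from the Gauss-Green formula
`∫_Ω ∂_v w = ∫_{∂Ω} w ⟪v, n⟫ dσ` (`HasC1Boundary.integral_fderivWithin`).

For the Gauss-Green formula on a domain with `C¹` boundary and Hausdorff measure as the boundary
measure, let `w` be supported in a small neighbourhood `V` of a boundary point. Integration by parts
against a cut-off that vanishes near `∂Ω` leaves an integral over a thin collar. In oblique
coordinates, along the tangent plane and along the axis of the graph, it tends to a flux integral
over the tangent plane (`IsGraphChart.integral_fderivWithin_eq_flux`). The graph map from that
plane to `∂Ω` is nearly an isometry on `V`, so `σ` and Lebesgue measure of the plane differ by a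
factor close to `1`.
This gives the formula up to an error `δ ∫ |w| dσ`, with `δ` as small as desired when `V` is small
(`HasC1Boundary.exists_nhds_abs_integral_sub_le`). A partition of unity adds up these estimates
without loss, since `∑ |ρᵢ w| = |w|`, and `δ → 0` gives the exact formula.
-/

/-! ### Measure-theoretic preliminaries -/

/-- Integrals with respect to two measures that agree up to a factor `1 + ε` differ by at most
`ε` times the integral of the absolute value. -/
theorem abs_integral_sub_integral_le {α : Type*} [MeasurableSpace α] {μ₁ μ₂ : Measure α} {ε : ℝ}
    (hε : 0 ≤ ε) (h₁ : μ₁ ≤ ENNReal.ofReal (1 + ε) • μ₂) (h₂ : μ₂ ≤ ENNReal.ofReal (1 + ε) • μ₁)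
    {a : α → ℝ} (ha : Integrable a μ₂) :
    Integrable a μ₁ ∧ ∫ x, |a x| ∂μ₁ ≤ (1 + ε) * ∫ x, |a x| ∂μ₂ ∧
      |∫ x, a x ∂μ₁ - ∫ x, a x ∂μ₂| ≤ ε * ∫ x, |a x| ∂μ₂ := by
  have ha₁ : Integrable a μ₁ := (ha.smul_measure ENNReal.ofReal_ne_top).mono_measure h₁
  have key : ∀ {ν₁ ν₂ : Measure α}, ν₁ ≤ ENNReal.ofReal (1 + ε) • ν₂ → ∀ {b : α → ℝ},
      (∀ x, 0 ≤ b x) → Integrable b ν₂ → ∫ x, b x ∂ν₁ ≤ (1 + ε) * ∫ x, b x ∂ν₂ := by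
    intro ν₁ ν₂ h b hb hi
    have := integral_mono_measure (μ := ν₁) h (ae_of_all _ hb)
      (hi.smul_measure ENNReal.ofReal_ne_top)
    rwa [integral_smul_measure, ENNReal.toReal_ofReal (by linarith), smul_eq_mul] at this
  have hp : ∀ x, 0 ≤ max (a x) 0 := fun x => le_max_right _ _
  have hn : ∀ x, 0 ≤ max (-a x) 0 := fun x => le_max_right _ _
  have p₁ := key h₁ hp ha.pos_part
  have n₁ := key h₁ hn ha.neg_part
  have p₂ := key h₂ hp ha₁.pos_part
  have n₂ := key h₂ hn ha₁.neg_part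
  have d₁ : ∫ x, a x ∂μ₁ = ∫ x, max (a x) 0 ∂μ₁ - ∫ x, max (-a x) 0 ∂μ₁ := by
    rw [← integral_sub ha₁.pos_part ha₁.neg_part]
    exact integral_congr_ae (ae_of_all _ fun x => (max_zero_sub_eq_self (a x)).symm)
  have d₂ : ∫ x, a x ∂μ₂ = ∫ x, max (a x) 0 ∂μ₂ - ∫ x, max (-a x) 0 ∂μ₂ := by
    rw [← integral_sub ha.pos_part ha.neg_part]
    exact integral_congr_ae (ae_of_all _ fun x => (max_zero_sub_eq_self (a x)).symm)
  have d₃ : ∫ x, |a x| ∂μ₂ = ∫ x, max (a x) 0 ∂μ₂ + ∫ x, max (-a x) 0 ∂μ₂ := by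
    rw [← integral_add ha.pos_part ha.neg_part]
    exact integral_congr_ae (ae_of_all _ fun x => (max_zero_add_max_neg_zero_eq_abs_self _).symm)
  have P : 0 ≤ ∫ x, max (a x) 0 ∂μ₂ := integral_nonneg hp
  have N : 0 ≤ ∫ x, max (-a x) 0 ∂μ₂ := integral_nonneg hn
  refine ⟨ha₁, key h₁ (fun x => abs_nonneg _) ha.abs, ?_⟩
  -- `x ≥ y / (1 + ε) ≥ (1 - ε) y`
  have lower : ∀ {x y : ℝ}, 0 ≤ y → y ≤ (1 + ε) * x → (1 - ε) * y ≤ x := by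
    intro x y hy h
    by_contra! hlt
    nlinarith [mul_lt_mul_of_pos_left hlt (by linarith : 0 < 1 + ε), mul_nonneg (sq_nonneg ε) hy]
  have p₃ := lower P p₂
  have n₃ := lower N n₂
  rw [d₁, d₂, d₃, abs_le]
  constructor <;> linarith

theorem euclideanHausdorffMeasure_image_le_of_lipschitzOnWith {X Y : Type*} [MetricSpace X]
    [MeasurableSpace X] [BorelSpace X] [MetricSpace Y] [MeasurableSpace Y] [BorelSpace Y]
    {d : ℕ} {K : NNReal} {g : X → Y} {A : Set X} (hg : LipschitzOnWith K g A) :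
    (μHE[d] : Measure Y) (g '' A) ≤ (K : ENNReal) ^ d * (μHE[d] : Measure X) A := by
  have := hg.hausdorffMeasure_image_le (d := d) (by positivity)
  simp only [Measure.euclideanHausdorffMeasure_def, Measure.smul_apply, ENNReal.smul_def,
    smul_eq_mul]
  rw [ENNReal.rpow_natCast] at this
  rw [mul_left_comm]
  gcongr

section MeasureTools

variable {E : Type*} [NormedAddCommGroup E] [InnerProductSpace ℝ E] [FiniteDimensional ℝ E]
  [MeasurableSpace E] [BorelSpace E]

theorem integral_fderiv_eq_zero_of_hasCompactSupport {f : E → ℝ} (hf : ContDiff ℝ 1 f)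
    (hc : HasCompactSupport f) (v : E) : ∫ x, fderiv ℝ f x v = 0 := by
  have hcont : Continuous fun x => fderiv ℝ f x v :=
    (hf.continuous_fderiv one_ne_zero).clm_apply continuous_const
  have hint : Integrable fun x => fderiv ℝ f x v :=
    hcont.integrable_of_hasCompactSupport (hc.fderiv_apply ℝ v)
  have := integral_mul_fderiv_eq_neg_fderiv_mul_of_integrable (μ := (volume : Measure E))
    (f := fun _ => (1 : ℝ)) (g := f) (v := v) (by simp) (by simpa using hint)
    (by simpa using hf.continuous.integrable_of_hasCompactSupport hc)
    (fun x _ => differentiableAt_const _) (fun x _ => hf.differentiable one_ne_zero x)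
  simpa using this

/-- The oblique coordinates `(z, τ) ↦ z + (τ - s z) e` over the hyperplane `ν^⊥`, where `s` is
an arbitrary function, multiply the volume by the constant `⟪ν, e⟫`. -/
theorem measurePreserving_obliqueCoordinates {ν e : E} (hν : ‖ν‖ = 1) (hpos : 0 < ⟪ν, e⟫_ℝ)
    {s : E → ℝ} (hs : Continuous s) :
    MeasurePreserving (fun q : ((ℝ ∙ ν)ᗮ : Submodule ℝ E) × ℝ => (q.1 : E) + (q.2 - s q.1) • e)
      volume (ENNReal.ofReal (⟪ν, e⟫_ℝ)⁻¹ • volume) := by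
  set c := ⟪ν, e⟫_ℝ with hc
  have hb : e - c • ν ∈ (ℝ ∙ ν)ᗮ := by
    rw [Submodule.mem_orthogonal_singleton_iff_inner_right, inner_sub_right, inner_smul_right,
      real_inner_self_eq_norm_sq, hν]
    simp [hc]
  set b : ((ℝ ∙ ν)ᗮ : Submodule ℝ E) := ⟨e - c • ν, hb⟩ with hbdef
  have m1 : MeasurePreserving
      (fun q : ((ℝ ∙ ν)ᗮ : Submodule ℝ E) × ℝ => (q.1, q.2 - s q.1))
      (volume.prod volume) (volume.prod volume) := by
    refine MeasurePreserving.skew_product (f := id)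
      (g := fun (z : ((ℝ ∙ ν)ᗮ : Submodule ℝ E)) τ => τ - s z) (MeasurePreserving.id _) ?_ ?_
    · exact (by fun_prop : Continuous fun q : ((ℝ ∙ ν)ᗮ : Submodule ℝ E) × ℝ =>
        q.2 - s q.1).measurable
    · exact ae_of_all _ fun z => (measurePreserving_sub_right volume (s z)).map_eq
  have m2 : MeasurePreserving
      (fun q : ℝ × ((ℝ ∙ ν)ᗮ : Submodule ℝ E) => (c * q.1, q.2 + q.1 • b))
      (volume.prod volume) ((ENNReal.ofReal c⁻¹ • volume).prod volume) := by
    refine MeasurePreserving.skew_product (f := fun t : ℝ => c * t)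
      (g := fun t w => w + t • b) ⟨by fun_prop, ?_⟩ ?_ ?_
    · rw [Real.map_volume_mul_left hpos.ne', abs_of_pos (inv_pos.2 hpos)]
    · exact (by fun_prop : Continuous fun q : ℝ × ((ℝ ∙ ν)ᗮ : Submodule ℝ E) =>
        q.2 + q.1 • b).measurable
    · exact ae_of_all _ fun t => (measurePreserving_add_right volume (t • b)).map_eq
  rw [Measure.prod_smul_left] at m2
  have m3 : MeasurePreserving (Prod.map (LinearIsometryEquiv.toSpanUnitSingleton (𝕜 := ℝ) ν hν)
      (id : ((ℝ ∙ ν)ᗮ : Submodule ℝ E) → _)) (volume.prod volume) (volume.prod volume) :=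
    (LinearIsometryEquiv.measurePreserving _).prod (MeasurePreserving.id _)
  have m4 := (Submodule.measurePreserving_measurableEquivProd (ℝ ∙ ν) (0 : E)).symm
  rw [InnerProductSpace.euclideanHausdorffMeasure_eq_volume, Measure.volume_eq_prod] at m4
  have m5 := ((m4.comp m3).smul_measure (ENNReal.ofReal c⁻¹)).comp
    (m2.comp (Measure.measurePreserving_swap.comp m1))
  refine (congrArg (fun f => MeasurePreserving f volume (ENNReal.ofReal c⁻¹ • volume)) ?_).mp m5
  funext q
  simp only [Function.comp_apply, Prod.swap_prod_mk, Prod.map_apply, id,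
    Submodule.measurableEquivProd_symm_apply, LinearIsometryEquiv.toSpanUnitSingleton_apply,
    hbdef, Submodule.coe_add, Submodule.coe_smul, vadd_eq_add, add_zero, smul_sub, smul_smul]
  rw [mul_comm c]
  abel

theorem integral_obliqueCoordinates {ν e : E} (hν : ‖ν‖ = 1) (hpos : 0 < ⟪ν, e⟫_ℝ)
    {s : E → ℝ} (hs : Continuous s) {F : E → ℝ} (hF : AEStronglyMeasurable F volume) :
    ∫ y, F y = ⟪ν, e⟫_ℝ *
      ∫ q : ((ℝ ∙ ν)ᗮ : Submodule ℝ E) × ℝ, F ((q.1 : E) + (q.2 - s q.1) • e) := by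
  have h := measurePreserving_obliqueCoordinates hν hpos hs
  rw [← integral_map h.measurable.aemeasurable (by rw [h.map_eq]; exact hF.smul_measure _),
    h.map_eq, integral_smul_measure, ENNReal.toReal_ofReal (inv_pos.2 hpos).le, smul_eq_mul,
    mul_inv_cancel_left₀ hpos.ne']

end MeasureTools

/-! ### Flux through a graph -/

section Flux

variable {E : Type*} [NormedAddCommGroup E] [InnerProductSpace ℝ E]

/-- `s` is a defining function of `Ω` on the open set `U` which measures, along the direction `e`,
the signed height above `∂Ω`. -/
structure IsGraphChart (Ω U : Set E) (e : E) (s : E → ℝ) : Prop where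
  isOpen : IsOpen U
  contDiff : ContDiff ℝ 1 s
  add_smul : ∀ y t, s (y + t • e) = s y + t
  mem_iff : ∀ y ∈ U, (y ∈ Ω ↔ s y < 0)

namespace IsGraphChart

variable {Ω U : Set E} {e : E} {s : E → ℝ}

theorem differentiable (h : IsGraphChart Ω U e s) : Differentiable ℝ s :=
  h.contDiff.differentiable one_ne_zero

theorem continuous_fderiv (h : IsGraphChart Ω U e s) : Continuous (fderiv ℝ s) :=
  h.contDiff.continuous_fderiv one_ne_zero

theorem fderiv_add_smul (h : IsGraphChart Ω U e s) (y : E) (t : ℝ) :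
    fderiv ℝ s (y + t • e) = fderiv ℝ s y := by
  rw [← fderiv_comp_add_right]
  simp_rw [h.add_smul]
  exact fderiv_add_const t

theorem fderiv_apply_self (h : IsGraphChart Ω U e s) (y : E) : fderiv ℝ s y e = 1 := by
  have h1 := (h.differentiable y).hasFDerivAt.hasLineDerivAt e
  have h2 : HasLineDerivAt ℝ s 1 y e := by
    simp only [HasLineDerivAt, h.add_smul]
    simpa using (hasDerivAt_id (0 : ℝ)).const_add (s y)
  exact h1.unique h2

theorem mem_closure (h : IsGraphChart Ω U e s) {y : E} (hy : y ∈ U) (hs : s y ≤ 0) :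
    y ∈ closure Ω := by
  have hc : Tendsto (fun t : ℝ => y + t • e) (𝓝[<] 0) (𝓝 y) := by
    have : Continuous fun t : ℝ => y + t • e := by fun_prop
    simpa using (this.tendsto 0).mono_left nhdsWithin_le_nhds
  refine mem_closure_of_tendsto hc ?_
  filter_upwards [hc (h.isOpen.mem_nhds hy), self_mem_nhdsWithin] with t ht ht0
  rw [h.mem_iff _ ht, h.add_smul]
  have : t < 0 := ht0
  linarith

theorem mem_closure_iff (h : IsGraphChart Ω U e s) {y : E} (hy : y ∈ U) :
    y ∈ closure Ω ↔ s y ≤ 0 := by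
  refine ⟨fun hc => ?_, h.mem_closure hy⟩
  by_contra! hpos
  obtain ⟨x, ⟨hx, hxU⟩, hxΩ⟩ := mem_closure_iff_nhds.1 hc _ (inter_mem
    (h.contDiff.continuous.continuousAt.preimage_mem_nhds (lt_mem_nhds hpos))
    (h.isOpen.mem_nhds hy))
  exact absurd ((h.mem_iff x hxU).1 hxΩ) (not_lt.2 (le_of_lt hx))

theorem mem_frontier_iff (h : IsGraphChart Ω U e s) (hΩ : IsOpen Ω) {y : E} (hy : y ∈ U) :
    y ∈ frontier Ω ↔ s y = 0 := by
  rw [hΩ.frontier_eq, Set.mem_sdiff, h.mem_closure_iff hy, h.mem_iff y hy, not_lt]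
  exact ⟨fun h => le_antisymm h.1 h.2, fun h => ⟨h.le, h.ge⟩⟩

end IsGraphChart

/-- A smooth step from `1` on `(-∞, -2]` down to `0` on `[-1, ∞)`. -/
theorem exists_smooth_step : ∃ η : ℝ → ℝ, ContDiff ℝ 1 η ∧ (∀ τ, |η τ| ≤ 1) ∧
    (∀ τ, -1 ≤ τ → η τ = 0) ∧ (∀ τ, τ ≤ -2 → η τ = 1) ∧ Continuous (deriv η) ∧
    Integrable (deriv η) ∧ ∫ τ, deriv η τ = -1 ∧ ∀ τ, -1 ≤ τ → deriv η τ = 0 := by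
  set η : ℝ → ℝ := fun τ => Real.smoothTransition (-τ - 1) with hη
  have hd : ContDiff ℝ 1 η := Real.smoothTransition.contDiff.comp (by fun_prop)
  have h0 : ∀ τ, -1 ≤ τ → η τ = 0 := fun τ h =>
    Real.smoothTransition.zero_of_nonpos (by linarith)
  have h1 : ∀ τ, τ ≤ -2 → η τ = 1 := fun τ h =>
    Real.smoothTransition.one_of_one_le (by linarith)
  have hcont : Continuous (deriv η) := hd.continuous_deriv le_rfl
  have hd0 : ∀ τ, -1 < τ → deriv η τ = 0 := fun τ h => by
    have : η =ᶠ[𝓝 τ] fun _ => 0 := by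
      filter_upwards [lt_mem_nhds h] with x hx using h0 x hx.le
    rw [this.deriv_eq, deriv_const]
  have hd0' : ∀ τ, -1 ≤ τ → deriv η τ = 0 := by
    have hcl : Set.Ici (-1 : ℝ) ⊆ {τ | deriv η τ = 0} := by
      rw [← closure_Ioi]
      exact closure_minimal (fun τ h => hd0 τ h) (isClosed_eq hcont continuous_const)
    exact fun τ h => hcl h
  have hd1 : ∀ τ, τ < -2 → deriv η τ = 0 := fun τ h => by
    have : η =ᶠ[𝓝 τ] fun _ => 1 := by
      filter_upwards [gt_mem_nhds h] with x hx using h1 x (le_of_lt hx)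
    rw [this.deriv_eq, deriv_const]
  have hcs : HasCompactSupport (deriv η) :=
    HasCompactSupport.intro (K := Set.Icc (-2) (-1)) isCompact_Icc fun τ hτ => by
      rcases lt_or_ge τ (-2) with h | h
      · exact hd1 τ h
      · exact hd0 τ (by by_contra! h'; exact hτ ⟨h, h'⟩)
  have hint := hcont.integrable_of_hasCompactSupport hcs (μ := volume)
  refine ⟨η, hd, fun τ => ?_, h0, h1, hcont, hint, ?_, hd0'⟩
  · rw [abs_of_nonneg (Real.smoothTransition.nonneg _)]
    exact Real.smoothTransition.le_one _
  · rw [integral_of_hasDerivAt_of_tendsto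
      (fun τ => (hd.differentiable one_ne_zero τ).hasDerivAt) hint
      (m := 1) (n := 0) ?_ ?_]
    · norm_num
    · refine tendsto_const_nhds.congr' ?_
      filter_upwards [eventually_le_atBot (-2)] with τ hτ using (h1 τ hτ).symm
    · refine tendsto_const_nhds.congr' ?_
      filter_upwards [eventually_ge_atTop (-1)] with τ hτ using (h0 τ hτ).symm

theorem fderivWithin_eq_fderiv_of_mem_open {Ω : Set E} (hΩ : IsOpen Ω) (w : E → ℝ) {x : E}
    (hx : x ∈ Ω) : fderivWithin ℝ w (closure Ω) x = fderiv ℝ w x :=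
  fderivWithin_of_mem_nhds (mem_of_superset (hΩ.mem_nhds hx) subset_closure)

variable [FiniteDimensional ℝ E] [MeasurableSpace E] [BorelSpace E]
  {Ω U : Set E} {e : E} {s : E → ℝ}

namespace IsGraphChart

/-- Integration by parts against the cut-off `η (s / ε)`, which vanishes near `∂Ω`. -/
theorem integral_cutoff_mul_fderivWithin (h : IsGraphChart Ω U e s) (hΩ : IsOpen Ω)
    (hb : Bornology.IsBounded Ω) (hud : UniqueDiffOn ℝ (closure Ω)) {w : E → ℝ}
    (hw : ContDiffOn ℝ 1 w (closure Ω)) (hsupp : tsupport w ⊆ U) (v : E)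
    {η : ℝ → ℝ} (hη : ContDiff ℝ 1 η) (hη0 : ∀ τ, -1 ≤ τ → η τ = 0) {ε : ℝ} (hε : 0 < ε) :
    ∫ x in Ω, η (s x / ε) * fderivWithin ℝ w (closure Ω) x v =
      -∫ x in Ω, w x * (deriv η (s x / ε) / ε * fderiv ℝ s x v) := by
  have hK : IsCompact (closure Ω) := hb.isCompact_closure
  set f : E → ℝ := Ω.indicator fun y => η (s y / ε) * w y with hf
  have hzero : ∀ y, y ∉ Ω → f =ᶠ[𝓝 y] fun _ => 0 := by
    intro y hy
    by_cases hyw : y ∈ tsupport w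
    · have hsy : 0 ≤ s y := not_lt.1 fun hlt => hy ((h.mem_iff y (hsupp hyw)).2 hlt)
      filter_upwards [h.contDiff.continuous.continuousAt.preimage_mem_nhds
        (lt_mem_nhds (show -ε < s y by linarith))] with x hx
      have : η (s x / ε) = 0 := hη0 _ (by
        rw [le_div_iff₀ hε]; have : -ε < s x := hx; linarith)
      simp [hf, Set.indicator, this]
    · filter_upwards [notMem_tsupport_iff_eventuallyEq.1 hyw] with x hx
      have : w x = 0 := hx
      simp [hf, Set.indicator, this]
  have hin : ∀ y ∈ Ω, f =ᶠ[𝓝 y] fun y => η (s y / ε) * w y := fun y hy => by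
    filter_upwards [hΩ.mem_nhds hy] with x hx using Set.indicator_of_mem hx _
  have hwat : ∀ y ∈ Ω, ContDiffAt ℝ 1 w y := fun y hy =>
    hw.contDiffAt (mem_of_superset (hΩ.mem_nhds hy) subset_closure)
  have hηs : ContDiff ℝ 1 fun y => η (s y / ε) := hη.comp (h.contDiff.div_const ε)
  have hfd : ContDiff ℝ 1 f := by
    rw [contDiff_iff_contDiffAt]
    intro y
    by_cases hy : y ∈ Ω
    · exact (hηs.contDiffAt.mul (hwat y hy)).congr_of_eventuallyEq (hin y hy)
    · exact contDiffAt_const.congr_of_eventuallyEq (hzero y hy)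
  have hfc : HasCompactSupport f := HasCompactSupport.intro hK fun y hy =>
    Set.indicator_of_notMem (fun hy' => hy (subset_closure hy')) _
  have hder : ∀ y, fderiv ℝ f y v = Ω.indicator (fun x =>
      η (s x / ε) * fderivWithin ℝ w (closure Ω) x v +
        w x * (deriv η (s x / ε) / ε * fderiv ℝ s x v)) y := by
    intro y
    by_cases hy : y ∈ Ω
    · rw [Set.indicator_of_mem hy, (hin y hy).fderiv_eq, fderivWithin_eq_fderiv_of_mem_open hΩ w hy]
      have d1 : HasFDerivAt (fun y => η (s y / ε))
          (deriv η (s y / ε) • (ε⁻¹ • fderiv ℝ s y)) y := by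
        have h1 : HasFDerivAt (fun y => s y / ε) (ε⁻¹ • fderiv ℝ s y) y := by
          simpa [div_eq_inv_mul] using (h.differentiable y).hasFDerivAt.const_mul ε⁻¹
        exact (hη.differentiable one_ne_zero (s y / ε)).hasDerivAt.comp_hasFDerivAt y h1
      rw [show (fun y => η (s y / ε) * w y) = (fun y => η (s y / ε)) * w from rfl,
        (d1.mul ((hwat y hy).differentiableAt one_ne_zero).hasFDerivAt).fderiv]
      simp only [_root_.add_apply, _root_.smul_apply, smul_eq_mul]
      ring
    · rw [Set.indicator_of_notMem hy, (hzero y hy).fderiv_eq]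
      simp
  have hmain := integral_fderiv_eq_zero_of_hasCompactSupport hfd hfc v
  simp_rw [hder] at hmain
  have hηc : Continuous fun x => η (s x / ε) := hηs.continuous
  have hηd : Continuous fun x => deriv η (s x / ε) / ε * fderiv ℝ s x v :=
    (((hη.continuous_deriv le_rfl).comp (h.contDiff.continuous.div_const ε)).div_const ε).mul
      (h.continuous_fderiv.clm_apply continuous_const)
  have i1 : IntegrableOn (fun x => η (s x / ε) * fderivWithin ℝ w (closure Ω) x v) Ω :=
    ((hηc.continuousOn.mul ((hw.continuousOn_fderivWithin hud le_rfl).clm_apply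
      continuousOn_const)).integrableOn_compact hK).mono_set subset_closure
  have i2 : IntegrableOn (fun x => w x * (deriv η (s x / ε) / ε * fderiv ℝ s x v)) Ω :=
    ((hw.continuousOn.mul hηd.continuousOn).integrableOn_compact hK).mono_set subset_closure
  rw [integral_indicator hΩ.measurableSet, integral_add i1 i2] at hmain
  linarith

/-- The integral of a derivative of `w` over `Ω` is the flux of `w` through the graph
`{s = 0}`, parametrized by any hyperplane `ν^⊥` transversal to `e`. -/
theorem integral_fderivWithin_eq_flux (h : IsGraphChart Ω U e s) (hΩ : IsOpen Ω)
    (hb : Bornology.IsBounded Ω) (hud : UniqueDiffOn ℝ (closure Ω)) {w : E → ℝ}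
    (hw : ContDiffOn ℝ 1 w (closure Ω)) (hsupp : tsupport w ⊆ U) (v : E)
    {ν : E} (hν : ‖ν‖ = 1) (hpos : 0 < ⟪ν, e⟫_ℝ) :
    ∫ x in Ω, fderivWithin ℝ w (closure Ω) x v = ⟪ν, e⟫_ℝ *
      ∫ z : ((ℝ ∙ ν)ᗮ : Submodule ℝ E), w ((z : E) - s z • e) * fderiv ℝ s z v := by
  have hK : IsCompact (closure Ω) := hb.isCompact_closure
  obtain ⟨η, hη, hη1, hη0, hηone, hDc, hDi, hDint, hD0⟩ := exists_smooth_step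
  set ε : ℕ → ℝ := fun n => 1 / ((n : ℝ) + 1) with hε
  have hεpos : ∀ n, 0 < ε n := fun n => by positivity
  have hεlim : Tendsto ε atTop (𝓝 0) := tendsto_one_div_add_atTop_nhds_zero_nat
  set D := deriv η with hD
  -- the volume integral converges
  have lim1 : Tendsto (fun n => ∫ x in Ω, η (s x / ε n) * fderivWithin ℝ w (closure Ω) x v) atTop
      (𝓝 (∫ x in Ω, fderivWithin ℝ w (closure Ω) x v)) := by
    have hcd : ContinuousOn (fun x => fderivWithin ℝ w (closure Ω) x v) (closure Ω) :=
      (hw.continuousOn_fderivWithin hud le_rfl).clm_apply continuousOn_const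
    have hi : IntegrableOn (fun x => fderivWithin ℝ w (closure Ω) x v) Ω :=
      (hcd.integrableOn_compact hK).mono_set subset_closure
    refine tendsto_integral_of_dominated_convergence
      (fun x => ‖fderivWithin ℝ w (closure Ω) x v‖) (fun n => ?_) hi.norm
      (fun n => ae_of_all _ fun x => ?_) ?_
    · have : Continuous fun x => η (s x / ε n) := hη.continuous.comp
        (h.contDiff.continuous.div_const _)
      exact this.aestronglyMeasurable.mul hi.aestronglyMeasurable
    · rw [norm_mul]
      exact mul_le_of_le_one_left (norm_nonneg _) (hη1 _)
    · refine (ae_restrict_mem hΩ.measurableSet).mono fun x hx => ?_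
      by_cases hxw : x ∈ tsupport w
      · have hsx : s x < 0 := (h.mem_iff x (hsupp hxw)).1 hx
        refine tendsto_const_nhds.congr' ?_
        have : ∀ᶠ n in atTop, ε n < -s x / 2 := hεlim.eventually (gt_mem_nhds (by linarith))
        filter_upwards [this] with n hn
        rw [hηone, one_mul]
        rw [div_le_iff₀ (hεpos n)]
        linarith
      · have hz : fderivWithin ℝ w (closure Ω) x v = 0 := by
          rw [fderivWithin_eq_fderiv_of_mem_open hΩ w hx,
            (notMem_tsupport_iff_eventuallyEq.1 hxw).fderiv_eq]
          simp [Pi.zero_def]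
        simp [hz]
  -- the collar integral in oblique coordinates, the height `s` being rescaled by `ε`
  have collar : ∀ n, ∫ x in Ω, η (s x / ε n) * fderivWithin ℝ w (closure Ω) x v =
      ⟪ν, e⟫_ℝ * ∫ q : ((ℝ ∙ ν)ᗮ : Submodule ℝ E) × ℝ,
        -(Ω.indicator w ((q.1 : E) - s q.1 • e + (ε n * q.2) • e) * fderiv ℝ s q.1 v) * D q.2 := by
    intro n
    rw [h.integral_cutoff_mul_fderivWithin hΩ hb hud hw hsupp v hη hη0 (hεpos n),
      ← integral_indicator hΩ.measurableSet]
    have hcont : ContinuousOn (fun x => w x * (deriv η (s x / ε n) / ε n * fderiv ℝ s x v)) Ω := by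
      refine (hw.continuousOn.mono subset_closure).mul (Continuous.continuousOn ?_)
      exact ((hDc.comp (h.contDiff.continuous.div_const _)).div_const _).mul
        (h.continuous_fderiv.clm_apply continuous_const)
    have hmeas : AEStronglyMeasurable (Ω.indicator fun x =>
        w x * (deriv η (s x / ε n) / ε n * fderiv ℝ s x v)) volume :=
      (aestronglyMeasurable_indicator_iff hΩ.measurableSet).2
        (hcont.aestronglyMeasurable hΩ.measurableSet)
    have hpos' : 0 < ⟪ν, ε n • e⟫_ℝ := by
      rw [inner_smul_right]; exact mul_pos (hεpos n) hpos
    rw [integral_obliqueCoordinates hν hpos' (h.contDiff.continuous.div_const (ε n)) hmeas,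
      inner_smul_right, mul_comm (ε n), mul_assoc, ← mul_neg, ← mul_neg, ← integral_neg,
      ← integral_const_mul]
    congr 2
    funext q
    have hy : (q.1 : E) + (q.2 - s q.1 / ε n) • ε n • e
        = (q.1 : E) - s q.1 • e + (ε n * q.2) • e := by
      rw [smul_smul, sub_mul, div_mul_cancel₀ _ (hεpos n).ne', sub_smul, mul_comm]
      abel
    rw [hy]
    have hyz : (q.1 : E) - s q.1 • e + (ε n * q.2) • e
        = (q.1 : E) + (ε n * q.2 - s q.1) • e := by
      rw [sub_smul]; abel
    by_cases hyΩ : (q.1 : E) - s q.1 • e + (ε n * q.2) • e ∈ Ω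
    · rw [Set.indicator_of_mem hyΩ, Set.indicator_of_mem hyΩ]
      have e1 : s ((q.1 : E) - s q.1 • e + (ε n * q.2) • e) = ε n * q.2 := by
        rw [hyz, h.add_smul]; ring
      have e2 : fderiv ℝ s ((q.1 : E) - s q.1 • e + (ε n * q.2) • e) = fderiv ℝ s q.1 := by
        rw [hyz, h.fderiv_add_smul]
      rw [e1, e2, mul_div_cancel_left₀ _ (hεpos n).ne']
      have hne := (hεpos n).ne'
      rw [hD]
      field_simp
    · rw [Set.indicator_of_notMem hyΩ, Set.indicator_of_notMem hyΩ]
      simp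
  obtain ⟨R, hR⟩ := hb.exists_norm_le
  obtain ⟨M, hM0, hM⟩ : ∃ M : ℝ, 0 ≤ M ∧ ∀ x ∈ closure Ω, ‖w x‖ ≤ M := by
    obtain ⟨M, hM⟩ := hK.exists_bound_of_continuousOn hw.continuousOn
    exact ⟨max M 0, le_max_right _ _, fun x hx => (hM x hx).trans (le_max_left _ _)⟩
  have hwm : Measurable (Ω.indicator w) := by
    classical
    have := ContinuousOn.measurable_piecewise (f := w) (g := fun _ => (0 : ℝ))
      (hw.continuousOn.mono subset_closure) continuousOn_const hΩ.measurableSet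
    rwa [show Ω.piecewise w (fun _ => (0 : ℝ)) = Ω.indicator w from
      Set.piecewise_eq_indicator] at this
  set R' := R + R / ⟪ν, e⟫_ℝ * ‖e‖ with hR'
  -- a point `z + t e` of the bounded set `Ω` has bounded base point `z`
  have hbase : ∀ (z : ((ℝ ∙ ν)ᗮ : Submodule ℝ E)) (t : ℝ), (z : E) + t • e ∈ Ω → ‖z‖ ≤ R' := by
    intro z t hzt
    have hn := hR _ hzt
    have hz0 : ⟪ν, (z : E)⟫_ℝ = 0 :=
      (Submodule.mem_orthogonal_singleton_iff_inner_right).1 z.2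
    have hin : ⟪ν, (z : E) + t • e⟫_ℝ = t * ⟪ν, e⟫_ℝ := by
      rw [inner_add_right, hz0, inner_smul_right, zero_add]
    have ht : |t| ≤ R / ⟪ν, e⟫_ℝ := by
      rw [le_div_iff₀ hpos]
      nth_rewrite 1 [← abs_of_pos hpos]
      rw [← abs_mul, ← hin]
      refine (abs_real_inner_le_norm _ _).trans ?_
      rw [hν, one_mul]
      exact hn
    calc ‖z‖ = ‖((z : E) + t • e) - t • e‖ := by simp
      _ ≤ ‖(z : E) + t • e‖ + ‖t • e‖ := norm_sub_le _ _
      _ ≤ R' := by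
        rw [norm_smul, Real.norm_eq_abs, hR']
        exact add_le_add hn (mul_le_mul_of_nonneg_right ht (norm_nonneg _))
  have hdsc : Continuous fun z : ((ℝ ∙ ν)ᗮ : Submodule ℝ E) => fderiv ℝ s z v :=
    (h.continuous_fderiv.comp continuous_subtype_val).clm_apply continuous_const
  have lim2 : Tendsto (fun n => ∫ q : ((ℝ ∙ ν)ᗮ : Submodule ℝ E) × ℝ,
        -(Ω.indicator w ((q.1 : E) - s q.1 • e + (ε n * q.2) • e) * fderiv ℝ s q.1 v) * D q.2) atTop
      (𝓝 (∫ q : ((ℝ ∙ ν)ᗮ : Submodule ℝ E) × ℝ,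
        -(w ((q.1 : E) - s q.1 • e) * fderiv ℝ s q.1 v) * D q.2)) := by
    refine tendsto_integral_of_dominated_convergence (fun q =>
      (closedBall (0 : ((ℝ ∙ ν)ᗮ : Submodule ℝ E)) R').indicator
        (fun z => M * ‖fderiv ℝ s z v‖) q.1 * ‖D q.2‖) (fun n => ?_) ?_
      (fun n => ae_of_all _ fun q => ?_) (ae_of_all _ fun q => ?_)
    · refine Measurable.aestronglyMeasurable ?_
      refine Measurable.mul (Measurable.neg (Measurable.mul (hwm.comp ?_) ?_)) ?_
      · have := h.contDiff.continuous
        exact (by fun_prop : Continuous fun q : ((ℝ ∙ ν)ᗮ : Submodule ℝ E) × ℝ =>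
          (q.1 : E) - s q.1 • e + (ε n * q.2) • e).measurable
      · exact (hdsc.comp continuous_fst).measurable
      · exact (hDc.comp continuous_snd).measurable
    · refine Integrable.mul_prod ?_ hDi.norm
      exact (integrable_indicator_iff isClosed_closedBall.measurableSet).2
        ((hdsc.norm.const_mul M).continuousOn.integrableOn_compact
          (isCompact_closedBall _ _))
    · rw [norm_mul, norm_neg, norm_mul]
      gcongr
      by_cases hyΩ : (q.1 : E) - s q.1 • e + (ε n * q.2) • e ∈ Ω
      · have hz : q.1 ∈ closedBall (0 : ((ℝ ∙ ν)ᗮ : Submodule ℝ E)) R' := by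
          rw [mem_closedBall_zero_iff]
          refine hbase q.1 (ε n * q.2 - s q.1) ?_
          rw [sub_smul]
          convert hyΩ using 1
          abel
        rw [Set.indicator_of_mem hyΩ, Set.indicator_of_mem hz]
        gcongr
        exact hM _ (subset_closure hyΩ)
      · rw [Set.indicator_of_notMem hyΩ, norm_zero, zero_mul]
        refine Set.indicator_nonneg (fun z _ => ?_) _
        exact mul_nonneg hM0 (norm_nonneg _)
    · rcases le_or_gt (-1) q.2 with hq | hq
      · simp [hD0 q.2 hq]
      refine ((Tendsto.mul_const _ ?_).neg).mul_const _
      have hyl : Tendsto (fun n => (q.1 : E) - s q.1 • e + (ε n * q.2) • e) atTop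
          (𝓝 ((q.1 : E) - s q.1 • e)) := by
        have := (((hεlim.mul_const q.2).smul_const e).const_add ((q.1 : E) - s q.1 • e))
        simpa using this
      have hs0 : s ((q.1 : E) - s q.1 • e) = 0 := by
        have := h.add_smul (q.1 : E) (-s q.1)
        rwa [neg_smul, ← sub_eq_add_neg, add_neg_cancel] at this
      by_cases hy : (q.1 : E) - s q.1 • e ∈ tsupport w
      · have hyU := hsupp hy
        have hin : ∀ᶠ n in atTop, (q.1 : E) - s q.1 • e + (ε n * q.2) • e ∈ Ω := by
          filter_upwards [hyl (h.isOpen.mem_nhds hyU)] with n hn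
          rw [h.mem_iff _ hn, h.add_smul, hs0, zero_add]
          exact mul_neg_of_pos_of_neg (hεpos n) (by linarith)
        have hwc := hw.continuousOn _ (h.mem_closure hyU hs0.le)
        refine (hwc.tendsto.comp (tendsto_nhdsWithin_iff.2
          ⟨hyl, hin.mono fun n hn => subset_closure hn⟩)).congr' ?_
        filter_upwards [hin] with n hn
        rw [Set.indicator_of_mem hn, Function.comp_apply]
      · have hz := notMem_tsupport_iff_eventuallyEq.1 hy
        rw [hz.eq_of_nhds]
        refine tendsto_const_nhds.congr' ?_
        filter_upwards [hyl.eventually hz] with n hn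
        simp only [Set.indicator, hn, Pi.zero_apply, ite_self]
  have hprod : ∫ q : ((ℝ ∙ ν)ᗮ : Submodule ℝ E) × ℝ,
        -(w ((q.1 : E) - s q.1 • e) * fderiv ℝ s q.1 v) * D q.2 =
      ∫ z : ((ℝ ∙ ν)ᗮ : Submodule ℝ E), w ((z : E) - s z • e) * fderiv ℝ s z v := by
    rw [Measure.volume_eq_prod, integral_prod_mul
      (f := fun z : ((ℝ ∙ ν)ᗮ : Submodule ℝ E) => -(w ((z : E) - s z • e) * fderiv ℝ s z v)),
      hDint, integral_neg]
    ring
  rw [← hprod]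
  simp_rw [collar] at lim1
  exact tendsto_nhds_unique lim1 (lim2.const_mul _)

end IsGraphChart

end Flux

/-! ### Comparing the flux with the surface integral -/

section Surface

variable {E : Type*} [NormedAddCommGroup E] [InnerProductSpace ℝ E]

/-- The projection onto the hyperplane `ν^⊥` along `e` (meaningful if `⟪ν, e⟫ ≠ 0`). -/
noncomputable def obliqueProjection (ν e : E) : E →L[ℝ] ((ℝ ∙ ν)ᗮ : Submodule ℝ E) :=
  ((ℝ ∙ ν)ᗮ : Submodule ℝ E).orthogonalProjectionOnto ∘L
    (ContinuousLinearMap.id ℝ E - ((⟪ν, e⟫_ℝ)⁻¹ • innerSL ℝ ν).smulRight e)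

theorem coe_obliqueProjection {ν e : E} (h : ⟪ν, e⟫_ℝ ≠ 0) (y : E) :
    (obliqueProjection ν e y : E) = y - (⟪ν, y⟫_ℝ / ⟪ν, e⟫_ℝ) • e := by
  have hmem : y - (⟪ν, y⟫_ℝ / ⟪ν, e⟫_ℝ) • e ∈ ((ℝ ∙ ν)ᗮ : Submodule ℝ E) := by
    rw [Submodule.mem_orthogonal_singleton_iff_inner_right, inner_sub_right, inner_smul_right,
      div_mul_cancel₀ _ h, sub_self]
  have : (ContinuousLinearMap.id ℝ E - ((⟪ν, e⟫_ℝ)⁻¹ • innerSL ℝ ν).smulRight e) y =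
      y - (⟪ν, y⟫_ℝ / ⟪ν, e⟫_ℝ) • e := by
    simp [div_eq_inv_mul]
  rw [obliqueProjection, ContinuousLinearMap.comp_apply, this]
  exact Submodule.starProjection_eq_self_iff.2 hmem

/-- The parametrization of the graph `{s = 0}` over the hyperplane `ν^⊥`, along `e`. -/
noncomputable def graphMap (ν e : E) (s : E → ℝ) (z : ((ℝ ∙ ν)ᗮ : Submodule ℝ E)) : E :=
  (z : E) - s z • e

namespace IsGraphChart

variable {Ω U : Set E} {e ν : E} {s : E → ℝ}

theorem apply_graphMap (h : IsGraphChart Ω U e s) (z : ((ℝ ∙ ν)ᗮ : Submodule ℝ E)) :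
    s (graphMap ν e s z) = 0 := by
  have := h.add_smul (z : E) (-s z)
  rwa [neg_smul, ← sub_eq_add_neg, add_neg_cancel] at this

theorem fderiv_graphMap (h : IsGraphChart Ω U e s) (z : ((ℝ ∙ ν)ᗮ : Submodule ℝ E)) :
    fderiv ℝ s (graphMap ν e s z) = fderiv ℝ s z := by
  have := h.fderiv_add_smul (z : E) (-s z)
  rwa [neg_smul, ← sub_eq_add_neg] at this

theorem continuous_graphMap (h : IsGraphChart Ω U e s) : Continuous (graphMap ν e s) := by
  have := h.contDiff.continuous
  unfold graphMap
  fun_prop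

theorem obliqueProjection_graphMap (hνe : ⟪ν, e⟫_ℝ ≠ 0) (z : ((ℝ ∙ ν)ᗮ : Submodule ℝ E)) :
    obliqueProjection ν e (graphMap ν e s z) = z := by
  have hz0 : ⟪ν, (z : E)⟫_ℝ = 0 := Submodule.mem_orthogonal_singleton_iff_inner_right.1 z.2
  apply Subtype.ext
  rw [coe_obliqueProjection hνe, graphMap, inner_sub_right, hz0, inner_smul_right, zero_sub,
    neg_div, mul_div_cancel_right₀ _ hνe, neg_smul]
  abel

theorem graphMap_obliqueProjection (h : IsGraphChart Ω U e s) (hνe : ⟪ν, e⟫_ℝ ≠ 0) {y : E}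
    (hy : s y = 0) : graphMap ν e s (obliqueProjection ν e y) = y := by
  have := h.add_smul y (-(⟪ν, y⟫_ℝ / ⟪ν, e⟫_ℝ))
  rw [neg_smul, ← sub_eq_add_neg, hy, zero_add] at this
  rw [graphMap, coe_obliqueProjection hνe, this, neg_smul]
  abel

theorem fderiv_obliqueProjection (h : IsGraphChart Ω U e s) (hνe : ⟪ν, e⟫_ℝ ≠ 0) (y : E) :
    fderiv ℝ s (obliqueProjection ν e y) = fderiv ℝ s y := by
  rw [coe_obliqueProjection hνe, sub_eq_add_neg, ← neg_smul, h.fderiv_add_smul]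

theorem measurableEmbedding_graphMap [MeasurableSpace E] [BorelSpace E]
    (h : IsGraphChart Ω U e s) (hνe : ⟪ν, e⟫_ℝ ≠ 0) :
    MeasurableEmbedding (graphMap ν e s) := by
  have hl : Function.LeftInverse (obliqueProjection ν e) (graphMap ν e s) :=
    obliqueProjection_graphMap hνe
  exact (hl.isClosedEmbedding (obliqueProjection ν e).continuous
    h.continuous_graphMap).measurableEmbedding

variable [FiniteDimensional ℝ E]

theorem gradient_ne_zero (h : IsGraphChart Ω U e s) (y : E) : gradient s y ≠ 0 := by
  intro h0
  have := h.fderiv_apply_self y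
  rw [← inner_gradient_left, h0, inner_zero_left] at this
  exact zero_ne_one this

theorem norm_gradient (y : E) : ‖gradient s y‖ = ‖fderiv ℝ s y‖ := by
  simp [gradient]

/-- Near a point `x₀`, the graph over the tangent plane at `x₀` has small slope. -/
theorem exists_ball_slope_le (h : IsGraphChart Ω U e s) {x₀ : E}
    (hν : ν = ‖gradient s x₀‖⁻¹ • gradient s x₀) {ε : ℝ} (hε : 0 < ε) : ∃ ρ > 0,
    (∀ z ∈ ball (obliqueProjection ν e x₀) ρ, |⟪ν, e⟫_ℝ * ‖gradient s z‖ - 1| ≤ ε) ∧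
    ∀ z₁ ∈ ball (obliqueProjection ν e x₀) ρ, ∀ z₂ ∈ ball (obliqueProjection ν e x₀) ρ,
      ‖(s z₁ - s z₂) • e‖ ≤ ε * ‖z₁ - z₂‖ := by
  have hg := norm_pos_iff.2 (h.gradient_ne_zero x₀)
  have hc : ⟪ν, e⟫_ℝ = ‖gradient s x₀‖⁻¹ := by
    rw [hν, real_inner_smul_left, inner_gradient_left, h.fderiv_apply_self, mul_one]
  have hνe : ⟪ν, e⟫_ℝ ≠ 0 := by rw [hc]; exact (inv_pos.2 hg).ne'
  have hcont : Continuous fun z : ((ℝ ∙ ν)ᗮ : Submodule ℝ E) => fderiv ℝ s z :=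
    h.continuous_fderiv.comp continuous_subtype_val
  have hz₀ := h.fderiv_obliqueProjection hνe x₀
  have hev₁ : ∀ᶠ z : ((ℝ ∙ ν)ᗮ : Submodule ℝ E) in 𝓝 (obliqueProjection ν e x₀),
      |⟪ν, e⟫_ℝ * ‖gradient s z‖ - 1| < ε := by
    have : Continuous fun z : ((ℝ ∙ ν)ᗮ : Submodule ℝ E) =>
        |⟪ν, e⟫_ℝ * ‖gradient s z‖ - 1| := by
      simp_rw [norm_gradient]
      fun_prop
    refine this.continuousAt.eventually (gt_mem_nhds ?_)
    beta_reduce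
    rw [norm_gradient, hz₀, ← norm_gradient, hc, inv_mul_cancel₀ hg.ne']
    simpa using hε
  have hev₂ : ∀ᶠ z : ((ℝ ∙ ν)ᗮ : Submodule ℝ E) in 𝓝 (obliqueProjection ν e x₀),
      ‖fderiv ℝ s z - fderiv ℝ s x₀‖ < ε / (‖e‖ + 1) := by
    have : Continuous fun z : ((ℝ ∙ ν)ᗮ : Submodule ℝ E) =>
        ‖fderiv ℝ s z - fderiv ℝ s x₀‖ := by fun_prop
    refine this.continuousAt.eventually (gt_mem_nhds ?_)
    beta_reduce
    rw [hz₀, sub_self, norm_zero]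
    positivity
  obtain ⟨ρ, hρ, hball⟩ := Metric.eventually_nhds_iff_ball.1 (hev₁.and hev₂)
  refine ⟨ρ, hρ, fun z hz => (hball z hz).1.le, fun z₁ h₁ z₂ h₂ => ?_⟩
  have hlip := (convex_ball (obliqueProjection ν e x₀) ρ).norm_image_sub_le_of_norm_hasFDerivWithin_le
    (f := fun z : ((ℝ ∙ ν)ᗮ : Submodule ℝ E) => s z)
    (f' := fun z => fderiv ℝ s z ∘L ((ℝ ∙ ν)ᗮ : Submodule ℝ E).subtypeL)
    (C := ε / (‖e‖ + 1)) (fun z _ => ?_) (fun z hz => ?_) h₂ h₁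
  · rw [norm_smul]
    calc ‖s z₁ - s z₂‖ * ‖e‖ ≤ (ε / (‖e‖ + 1) * ‖z₁ - z₂‖) * ‖e‖ := by gcongr
      _ = ε * ‖z₁ - z₂‖ * (‖e‖ / (‖e‖ + 1)) := by ring
      _ ≤ ε * ‖z₁ - z₂‖ * 1 := by
        gcongr
        rw [div_le_one (by positivity)]
        linarith
      _ = ε * ‖z₁ - z₂‖ := mul_one _
  · exact ((h.differentiable z).hasFDerivAt.comp z
      (((ℝ ∙ ν)ᗮ : Submodule ℝ E).subtypeL.hasFDerivAt)).hasFDerivWithinAt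
  · refine ContinuousLinearMap.opNorm_le_bound _ (by positivity) fun y => ?_
    have hy0 : fderiv ℝ s x₀ y = 0 := by
      have h1 := Submodule.mem_orthogonal_singleton_iff_inner_right.1 y.2
      have h2 : ∀ y, ⟪ν, y⟫_ℝ = ‖gradient s x₀‖⁻¹ * fderiv ℝ s x₀ y := fun y => by
        rw [hν, real_inner_smul_left, inner_gradient_left]
      rw [h2] at h1
      exact (mul_eq_zero.1 h1).resolve_left (inv_pos.2 hg).ne'
    have : (fderiv ℝ s z ∘L ((ℝ ∙ ν)ᗮ : Submodule ℝ E).subtypeL) y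
        = (fderiv ℝ s z - fderiv ℝ s x₀) y := by
      simp [hy0]
    rw [this]
    exact (ContinuousLinearMap.le_opNorm _ _).trans
      (mul_le_mul_of_nonneg_right (hball z hz).2.le (norm_nonneg _))

variable [MeasurableSpace E] [BorelSpace E]

/-- Near a point `x₀`, the parametrization of the graph over the tangent plane at `x₀` almost
preserves the area. -/
theorem exists_ball_area_le (h : IsGraphChart Ω U e s) {x₀ : E}
    (hν : ν = ‖gradient s x₀‖⁻¹ • gradient s x₀) {ε : ℝ} (hε : 0 < ε) : ∃ ρ > 0,
    (∀ z ∈ ball (obliqueProjection ν e x₀) ρ, |⟪ν, e⟫_ℝ * ‖gradient s z‖ - 1| ≤ ε) ∧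
    ∀ A ⊆ ball (obliqueProjection ν e x₀) ρ,
      (μHE[Module.finrank ℝ E - 1] : Measure E) (graphMap ν e s '' A)
        ≤ ENNReal.ofReal (1 + ε) * volume A ∧
      volume A ≤ ENNReal.ofReal (1 + ε) *
        (μHE[Module.finrank ℝ E - 1] : Measure E) (graphMap ν e s '' A) := by
  have hg := norm_pos_iff.2 (h.gradient_ne_zero x₀)
  have hc : ⟪ν, e⟫_ℝ = ‖gradient s x₀‖⁻¹ := by
    rw [hν, real_inner_smul_left, inner_gradient_left, h.fderiv_apply_self, mul_one]
  have hνe : ⟪ν, e⟫_ℝ ≠ 0 := by rw [hc]; exact (inv_pos.2 hg).ne'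
  have hν0 : ν ≠ 0 := fun h0 => hνe (by rw [h0, inner_zero_left])
  set d := Module.finrank ℝ E - 1 with hd
  have hfin : Module.finrank ℝ ((ℝ ∙ ν)ᗮ : Submodule ℝ E) = d := by
    have := (ℝ ∙ ν).finrank_add_finrank_orthogonal
    rw [finrank_span_singleton hν0] at this
    omega
  have hvol : (volume : Measure ((ℝ ∙ ν)ᗮ : Submodule ℝ E)) = μHE[d] := by
    rw [← InnerProductSpace.euclideanHausdorffMeasure_eq_volume, hfin]
  obtain ⟨K, hKd, hK1⟩ : ∃ K : ℝ, K ^ d < 1 + ε ∧ 1 < K := by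
    have h1 : ∀ᶠ K in 𝓝[>] (1 : ℝ), K ^ d < 1 + ε := by
      have : Continuous fun K : ℝ => K ^ d := by fun_prop
      refine (this.tendsto 1).mono_left nhdsWithin_le_nhds |>.eventually (gt_mem_nhds ?_)
      rw [one_pow]; linarith
    exact (h1.and self_mem_nhdsWithin).exists
  have hK0 : 0 < K := by linarith
  have hKinv : K⁻¹ < 1 := inv_lt_one_of_one_lt₀ hK1
  have hKK : 2 ≤ K + K⁻¹ := by
    have : 0 ≤ K⁻¹ * (K - 1) ^ 2 := by positivity
    have h2 : K⁻¹ * (K - 1) ^ 2 = K + K⁻¹ - 2 := by field_simp; ring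
    linarith
  obtain ⟨ρ, hρ, hr, hs⟩ := h.exists_ball_slope_le hν
    (lt_min hε (show 0 < 1 - K⁻¹ by linarith))
  set B := ball (obliqueProjection ν e x₀) ρ with hB
  have hs' : ∀ z₁ ∈ B, ∀ z₂ ∈ B, ‖(s z₁ - s z₂) • e‖ ≤ (1 - K⁻¹) * ‖z₁ - z₂‖ :=
    fun z₁ h₁ z₂ h₂ => (hs z₁ h₁ z₂ h₂).trans
      (mul_le_mul_of_nonneg_right (min_le_right _ _) (norm_nonneg _))
  have hdiff : ∀ z₁ z₂ : ((ℝ ∙ ν)ᗮ : Submodule ℝ E), graphMap ν e s z₁ - graphMap ν e s z₂ =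
      ((z₁ - z₂ : ((ℝ ∙ ν)ᗮ : Submodule ℝ E)) : E) - (s z₁ - s z₂) • e := by
    intro z₁ z₂
    rw [graphMap, graphMap, sub_smul, Submodule.coe_sub]
    abel
  have lip₁ : LipschitzOnWith K.toNNReal (graphMap ν e s) B := by
    refine LipschitzOnWith.of_dist_le_mul fun z₁ h₁ z₂ h₂ => ?_
    rw [Real.coe_toNNReal _ hK0.le, dist_eq_norm, dist_eq_norm, hdiff]
    refine (norm_sub_le _ _).trans ?_
    have := hs' z₁ h₁ z₂ h₂
    rw [Submodule.coe_norm]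
    rw [Submodule.coe_norm] at this
    nlinarith [norm_nonneg ((z₁ - z₂ : ((ℝ ∙ ν)ᗮ : Submodule ℝ E)) : E)]
  have lip₂ : LipschitzOnWith K.toNNReal (obliqueProjection ν e) (graphMap ν e s '' B) := by
    refine LipschitzOnWith.of_dist_le_mul ?_
    rintro _ ⟨z₁, h₁, rfl⟩ _ ⟨z₂, h₂, rfl⟩
    rw [Real.coe_toNNReal _ hK0.le, obliqueProjection_graphMap hνe, obliqueProjection_graphMap hνe,
      dist_eq_norm, dist_eq_norm, hdiff, ← div_le_iff₀' hK0, div_eq_inv_mul]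
    have h1 := hs' z₁ h₁ z₂ h₂
    have h2 := norm_sub_norm_le (((z₁ - z₂ : ((ℝ ∙ ν)ᗮ : Submodule ℝ E)) : E)) ((s z₁ - s z₂) • e)
    rw [← Submodule.coe_norm] at h2
    linarith
  have hKE : ((K.toNNReal : NNReal) : ENNReal) ^ d ≤ ENNReal.ofReal (1 + ε) := by
    have : ((K.toNNReal : NNReal) : ENNReal) = ENNReal.ofReal K := rfl
    rw [this, ← ENNReal.ofReal_pow hK0.le]
    exact ENNReal.ofReal_le_ofReal hKd.le
  refine ⟨ρ, hρ, fun z hz => (hr z hz).trans (min_le_left _ _), fun A hA => ⟨?_, ?_⟩⟩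
  · rw [hvol]
    exact (euclideanHausdorffMeasure_image_le_of_lipschitzOnWith (lip₁.mono hA)).trans
      (mul_le_mul_left hKE _)
  · rw [hvol]
    have := euclideanHausdorffMeasure_image_le_of_lipschitzOnWith (d := d)
      (lip₂.mono (Set.image_mono hA))
    rw [Set.image_image] at this
    simp_rw [obliqueProjection_graphMap hνe, Set.image_id'] at this
    exact this.trans (mul_le_mul_left hKE _)

/-- Up to an arbitrarily small relative error, the Gauss-Green formula holds for functions supported
near a given boundary point. -/
theorem exists_nhds_abs_integral_sub_le (h : IsGraphChart Ω U e s) (hΩ : IsOpen Ω)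
    (hb : Bornology.IsBounded Ω) (hud : UniqueDiffOn ℝ (closure Ω)) {n : E → E}
    (hn : ∀ y ∈ U, s y = 0 → n y = ‖gradient s y‖⁻¹ • gradient s y) {x₀ : E} (hx₀ : x₀ ∈ U)
    {δ : ℝ} (hδ : 0 < δ) : ∃ V, IsOpen V ∧ x₀ ∈ V ∧
      (μHE[Module.finrank ℝ E - 1] : Measure E) (frontier Ω ∩ V) < ⊤ ∧
      ∀ w : E → ℝ, ContDiffOn ℝ 1 w (closure Ω) → tsupport w ⊆ V → ∀ v : E,
        |(∫ x in Ω, fderivWithin ℝ w (closure Ω) x v) -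
            ∫ x in frontier Ω, w x * ⟪v, n x⟫_ℝ ∂μHE[Module.finrank ℝ E - 1]| ≤
          δ * (‖v‖ * ∫ x in frontier Ω, |w x| ∂μHE[Module.finrank ℝ E - 1]) := by
  have hg := norm_pos_iff.2 (h.gradient_ne_zero x₀)
  obtain ⟨ν, hν⟩ : ∃ ν, ν = ‖gradient s x₀‖⁻¹ • gradient s x₀ := ⟨_, rfl⟩
  have hν1 : ‖ν‖ = 1 := by
    rw [hν, norm_smul, norm_inv, norm_norm, inv_mul_cancel₀ hg.ne']
  have hc : ⟪ν, e⟫_ℝ = ‖gradient s x₀‖⁻¹ := by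
    rw [hν, real_inner_smul_left, inner_gradient_left, h.fderiv_apply_self, mul_one]
  have hpos : 0 < ⟪ν, e⟫_ℝ := by rw [hc]; exact inv_pos.2 hg
  have hνe := hpos.ne'
  set σ : Measure E := μHE[Module.finrank ℝ E - 1] with hσ
  set ε := min 1 (δ / 3) with hε
  have hε0 : 0 < ε := lt_min one_pos (by positivity)
  have hε1 : ε ≤ 1 := min_le_left _ _
  have hεδ : 3 * ε ≤ δ := by
    have : ε ≤ δ / 3 := min_le_right _ _
    linarith
  obtain ⟨ρ, hρ, hJ, harea⟩ := h.exists_ball_area_le hν hε0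
  set B := ball (obliqueProjection ν e x₀) ρ with hB
  set Γ := graphMap ν e s with hΓ
  have hΓm := h.measurableEmbedding_graphMap hνe
  have hΓc : Continuous Γ := h.continuous_graphMap
  set V := U ∩ obliqueProjection ν e ⁻¹' B with hV
  have hVo : IsOpen V := h.isOpen.inter (isOpen_ball.preimage (obliqueProjection ν e).continuous)
  have hfr : frontier Ω ∩ V = Γ '' (B ∩ Γ ⁻¹' U) := by
    ext y
    constructor
    · rintro ⟨hy, hyU, hyB⟩
      have hs0 := (h.mem_frontier_iff hΩ hyU).1 hy
      have e1 := h.graphMap_obliqueProjection hνe hs0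
      exact ⟨_, ⟨hyB, by rw [Set.mem_preimage, hΓ, e1]; exact hyU⟩, e1⟩
    · rintro ⟨z, ⟨hzB, hzU⟩, rfl⟩
      refine ⟨(h.mem_frontier_iff hΩ hzU).2 (h.apply_graphMap z), hzU, ?_⟩
      rw [Set.mem_preimage, hΓ, obliqueProjection_graphMap hνe]
      exact hzB
  set μ := (Measure.comap Γ σ).restrict B with hμ
  set lam := (volume : Measure ((ℝ ∙ ν)ᗮ : Submodule ℝ E)).restrict B with hlam
  have hBm : MeasurableSet B := isOpen_ball.measurableSet
  have le₁ : lam ≤ ENNReal.ofReal (1 + ε) • μ := by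
    refine Measure.le_iff.2 fun A hA => ?_
    rw [Measure.smul_apply, hlam, hμ, Measure.restrict_apply hA, Measure.restrict_apply hA,
      hΓm.comap_apply, smul_eq_mul]
    exact (harea _ Set.inter_subset_right).2
  have le₂ : μ ≤ ENNReal.ofReal (1 + ε) • lam := by
    refine Measure.le_iff.2 fun A hA => ?_
    rw [Measure.smul_apply, hlam, hμ, Measure.restrict_apply hA, Measure.restrict_apply hA,
      hΓm.comap_apply, smul_eq_mul]
    exact (harea _ Set.inter_subset_right).1
  refine ⟨V, hVo, ⟨hx₀, mem_ball_self hρ⟩, ?_, fun w hw hsupp v => ?_⟩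
  · rw [hfr]
    refine ((measure_mono (Set.image_mono Set.inter_subset_left)).trans
      (harea B subset_rfl).1).trans_lt ?_
    exact ENNReal.mul_lt_top ENNReal.ofReal_lt_top measure_ball_lt_top
  -- surface integrals of functions supported in `V` are integrals over the hyperplane
  have pull : ∀ G : E → ℝ, (∀ y, y ∉ V → G y = 0) →
      ∫ y in frontier Ω, G y ∂σ = ∫ z, G (Γ z) ∂μ := by
    intro G hG
    have hfm : MeasurableSet (frontier Ω ∩ V) :=
      isClosed_frontier.measurableSet.inter hVo.measurableSet
    have e1 : ∫ y in frontier Ω, G y ∂σ = ∫ y in frontier Ω ∩ V, G y ∂σ :=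
      setIntegral_eq_of_subset_of_forall_sdiff_eq_zero isClosed_frontier.measurableSet
        Set.inter_subset_left fun y hy => hG y fun hyV => hy.2 ⟨hy.1, hyV⟩
    have e2 : ∫ z, G (Γ z) ∂μ = ∫ z in B ∩ Γ ⁻¹' U, G (Γ z) ∂(Measure.comap Γ σ) :=
      setIntegral_eq_of_subset_of_forall_sdiff_eq_zero hBm
        Set.inter_subset_left fun z hz => hG _ fun hzV => hz.2 ⟨hz.1, hzV.1⟩
    have hsub : frontier Ω ∩ V ⊆ Set.range Γ := by
      rw [hfr]
      exact Set.image_subset_range _ _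
    have hr : σ.restrict (frontier Ω ∩ V) =
        (Measure.map Γ (Measure.comap Γ σ)).restrict (frontier Ω ∩ V) := by
      rw [hΓm.map_comap, Measure.restrict_restrict hfm,
        Set.inter_eq_left.2 hsub]
    rw [e1, e2, hr, hΓm.setIntegral_map, hfr, hΓm.injective.preimage_image]
  have hw0 : ∀ y, y ∉ V → w y = 0 := fun y hy =>
    image_eq_zero_of_notMem_tsupport fun hy' => hy (hsupp hy')
  have hwc : Continuous fun z => w (Γ z) := by
    rw [continuous_iff_continuousAt]
    intro z
    by_cases hz : Γ z ∈ tsupport w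
    · have hzU : Γ z ∈ U := (hsupp hz).1
      have hcl := h.mem_closure hzU (h.apply_graphMap z).le
      refine (hw.continuousOn _ hcl).tendsto.comp (tendsto_nhdsWithin_iff.2
        ⟨hΓc.continuousAt, ?_⟩)
      filter_upwards [hΓc.continuousAt.preimage_mem_nhds (h.isOpen.mem_nhds hzU)] with z' hz'
      exact h.mem_closure hz' (h.apply_graphMap z').le
    · have hz0 := notMem_tsupport_iff_eventuallyEq.1 hz
      exact (continuousAt_const (y := (0 : ℝ))).congr
        ((hΓc.continuousAt.eventually hz0).mono fun z' hz' => hz'.symm)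
  set a : ((ℝ ∙ ν)ᗮ : Submodule ℝ E) → ℝ :=
    fun z => w (Γ z) * (fderiv ℝ s z v / ‖gradient s z‖) with ha
  have hgn : ∀ z, ‖gradient s z‖ ≠ 0 := fun z => (norm_pos_iff.2 (h.gradient_ne_zero z)).ne'
  have hdc : Continuous fun z : ((ℝ ∙ ν)ᗮ : Submodule ℝ E) => fderiv ℝ s z :=
    h.continuous_fderiv.comp continuous_subtype_val
  have hgc : Continuous fun z : ((ℝ ∙ ν)ᗮ : Submodule ℝ E) => ‖gradient s z‖ := by
    simp_rw [norm_gradient]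
    exact hdc.norm
  have hac : Continuous a :=
    hwc.mul ((hdc.clm_apply continuous_const).div hgc fun z => hgn z)
  have hint : ∀ {b : ((ℝ ∙ ν)ᗮ : Submodule ℝ E) → ℝ}, Continuous b → Integrable b lam :=
    fun hb => (hb.continuousOn.integrableOn_compact (isCompact_closedBall _ _)).mono_set
      ball_subset_closedBall
  have hint' : ∀ {b : ((ℝ ∙ ν)ᗮ : Submodule ℝ E) → ℝ}, Continuous b → Integrable b μ :=
    fun hb => ((hint hb).smul_measure ENNReal.ofReal_ne_top).mono_measure le₂
  have hB0 : ∀ z, z ∉ B → w (Γ z) = 0 := fun z hz => hw0 _ fun hzV => by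
    have := hzV.2
    rw [Set.mem_preimage, hΓ, obliqueProjection_graphMap hνe] at this
    exact hz this
  have I₁ : ∫ x in Ω, fderivWithin ℝ w (closure Ω) x v =
      ∫ z, a z * (⟪ν, e⟫_ℝ * ‖gradient s z‖) ∂lam := by
    rw [h.integral_fderivWithin_eq_flux hΩ hb hud hw (hsupp.trans Set.inter_subset_left) v hν1 hpos,
      ← integral_const_mul, hlam, setIntegral_eq_integral_of_forall_compl_eq_zero]
    · refine integral_congr_ae (ae_of_all _ fun z => ?_)
      have := hgn z
      simp only [ha, hΓ, graphMap]
      field_simp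
    · intro z hz
      simp [ha, hB0 z hz]
  have I₂ : ∫ x in frontier Ω, w x * ⟪v, n x⟫_ℝ ∂σ = ∫ z, a z ∂μ := by
    rw [pull _ fun y hy => by rw [hw0 y hy, zero_mul]]
    refine integral_congr_ae (ae_of_all _ fun z => ?_)
    by_cases hz : Γ z ∈ V
    · have hgz : gradient s (Γ z) = gradient s z := by
        rw [gradient, gradient, hΓ, h.fderiv_graphMap]
      simp only [ha]
      rw [hn _ hz.1 (h.apply_graphMap z), hgz, inner_smul_right, real_inner_comm,
        inner_gradient_left, ← div_eq_inv_mul]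
    · simp [ha, hw0 _ hz]
  have I₃ : ∫ x in frontier Ω, |w x| ∂σ = ∫ z, |w (Γ z)| ∂μ :=
    pull _ fun y hy => by rw [hw0 y hy, abs_zero]
  obtain ⟨-, c₁, c₂⟩ := abs_integral_sub_integral_le hε0.le le₁ le₂ (hint' hac)
  have c₃ : |∫ z, a z * (⟪ν, e⟫_ℝ * ‖gradient s z‖) ∂lam - ∫ z, a z ∂lam| ≤
      ε * ∫ z, |a z| ∂lam := by
    have hac' : Continuous fun z => a z * (⟪ν, e⟫_ℝ * ‖gradient s z‖) :=
      hac.mul (continuous_const.mul hgc)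
    rw [← integral_sub (hint hac') (hint hac), ← integral_const_mul]
    refine (abs_integral_le_integral_abs).trans (integral_mono_ae ?_ ?_ ?_)
    · exact ((hint hac').sub (hint hac)).abs
    · exact ((hint hac).abs).const_mul ε
    · filter_upwards [ae_restrict_mem hBm] with z hz
      have : a z * (⟪ν, e⟫_ℝ * ‖gradient s z‖) - a z
          = (⟪ν, e⟫_ℝ * ‖gradient s z‖ - 1) * a z := by ring
      rw [this, abs_mul]
      exact mul_le_mul_of_nonneg_right (hJ z hz) (abs_nonneg _)
  have c₄ : ∫ z, |a z| ∂μ ≤ ‖v‖ * ∫ x in frontier Ω, |w x| ∂σ := by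
    rw [I₃, ← integral_const_mul]
    refine integral_mono (hint' hac).abs ((hint' hwc).abs.const_mul _) fun z => ?_
    simp only [ha]
    rw [abs_mul, mul_comm]
    refine mul_le_mul_of_nonneg_right ?_ (abs_nonneg _)
    rw [abs_div, abs_norm, div_le_iff₀ (norm_pos_iff.2 (h.gradient_ne_zero z)), norm_gradient,
      mul_comm]
    exact (fderiv ℝ s z).le_opNorm v
  have hnn : 0 ≤ ∫ z, |a z| ∂μ := integral_nonneg fun z => abs_nonneg _
  rw [I₁, I₂]
  calc _ ≤ |∫ z, a z * (⟪ν, e⟫_ℝ * ‖gradient s z‖) ∂lam - ∫ z, a z ∂lam| +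
        |∫ z, a z ∂lam - ∫ z, a z ∂μ| := abs_sub_le _ _ _
    _ ≤ ε * ((1 + ε) * ∫ z, |a z| ∂μ) + ε * ∫ z, |a z| ∂μ :=
      add_le_add (c₃.trans (mul_le_mul_of_nonneg_left c₁ hε0.le)) c₂
    _ = ε * (2 + ε) * ∫ z, |a z| ∂μ := by ring
    _ ≤ δ * ∫ z, |a z| ∂μ := by
      refine mul_le_mul_of_nonneg_right ?_ hnn
      nlinarith
    _ ≤ _ := mul_le_mul_of_nonneg_left c₄ hδ.le

end IsGraphChart

end Surface

/-! ### The Gauss-Green formula -/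

section GaussGreen

variable {m : ℕ} {Ω U : Set (EuclideanSpace ℝ (Fin m))}

theorem HasC1Boundary.exists_isGraphChart (hΩ1 : HasC1Boundary Ω) {x : EuclideanSpace ℝ (Fin m)}
    (hx : x ∈ frontier Ω) : ∃ U e s, x ∈ U ∧ IsGraphChart Ω U e s := by
  obtain ⟨U, hU, hxU, e, φ, he, hφ, hiff⟩ := hΩ1 x hx
  refine ⟨U, e, fun y => ⟪e, y⟫_ℝ - φ (y - ⟪e, y⟫_ℝ • e), hxU, hU, ?_, fun y t => ?_, fun y hy => ?_⟩
  · exact (contDiff_const.inner ℝ contDiff_id).sub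
      (hφ.comp (contDiff_id.sub ((contDiff_const.inner ℝ contDiff_id).smul contDiff_const)))
  · have h1 : ⟪e, y + t • e⟫_ℝ = ⟪e, y⟫_ℝ + t := by
      rw [inner_add_right, inner_smul_right, real_inner_self_eq_norm_sq, he, one_pow, mul_one]
    have h2 : y + t • e - (⟪e, y⟫_ℝ + t) • e = y - ⟪e, y⟫_ℝ • e := by
      rw [add_smul]; abel
    simp only [h1, h2]
    ring
  · rw [hiff y hy, sub_neg]

theorem IsGraphChart.isOutwardUnitNormal {e : EuclideanSpace ℝ (Fin m)}
    {s : EuclideanSpace ℝ (Fin m) → ℝ} (h : IsGraphChart Ω U e s)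
    {y : EuclideanSpace ℝ (Fin m)} (hy : y ∈ U) (hs : s y = 0) :
    IsOutwardUnitNormal Ω y (‖gradient s y‖⁻¹ • gradient s y) := by
  have hg := norm_pos_iff.2 (h.gradient_ne_zero y)
  have hin : ∀ v, ⟪v, ‖gradient s y‖⁻¹ • gradient s y⟫_ℝ = ‖gradient s y‖⁻¹ * fderiv ℝ s y v :=
    fun v => by rw [inner_smul_right, real_inner_comm, inner_gradient_left]
  have hslope : ∀ v, Tendsto (fun t : ℝ => t⁻¹ * s (y + t • v)) (𝓝[>] 0) (𝓝 (fderiv ℝ s y v)) := by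
    intro v
    have := ((h.differentiable y).hasFDerivAt.hasLineDerivAt v).tendsto_slope_zero_right
    simpa [hs] using this
  have hmemU : ∀ v, ∀ᶠ t : ℝ in 𝓝[>] 0, y + t • v ∈ U := by
    intro v
    have hc : Continuous fun t : ℝ => y + t • v := by fun_prop
    have : Tendsto (fun t : ℝ => y + t • v) (𝓝[>] 0) (𝓝 y) := by
      simpa using (hc.tendsto 0).mono_left nhdsWithin_le_nhds
    exact this (h.isOpen.mem_nhds hy)
  refine ⟨by rw [norm_smul, norm_inv, norm_norm, inv_mul_cancel₀ hg.ne'], fun v hv => ?_,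
    fun v hv => ?_⟩
  · rw [hin] at hv
    have hv' : fderiv ℝ s y v < 0 := (pos_iff_neg_of_mul_neg hv).1 (inv_pos.2 hg)
    filter_upwards [(hslope v).eventually (gt_mem_nhds hv'), hmemU v, self_mem_nhdsWithin]
      with t ht htU ht0
    rw [h.mem_iff _ htU]
    exact (pos_iff_neg_of_mul_neg ht).1 (inv_pos.2 ht0)
  · rw [hin] at hv
    have hv' : 0 < fderiv ℝ s y v := (pos_iff_pos_of_mul_pos hv).1 (inv_pos.2 hg)
    filter_upwards [(hslope v).eventually (lt_mem_nhds hv'), hmemU v, self_mem_nhdsWithin]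
      with t ht htU ht0
    rw [h.mem_closure_iff htU, not_le]
    exact (pos_iff_pos_of_mul_pos ht).1 (inv_pos.2 ht0)

theorem IsGraphChart.outwardUnitNormal_eq {e : EuclideanSpace ℝ (Fin m)}
    {s : EuclideanSpace ℝ (Fin m) → ℝ} (h : IsGraphChart Ω U e s)
    {y : EuclideanSpace ℝ (Fin m)} (hy : y ∈ U) (hs : s y = 0) :
    outwardUnitNormal Ω y = ‖gradient s y‖⁻¹ • gradient s y :=
  (h.isOutwardUnitNormal hy hs).outwardUnitNormal_eq

theorem HasC1Boundary.continuousOn_outwardUnitNormal (hΩ1 : HasC1Boundary Ω) (hΩ : IsOpen Ω) :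
    ContinuousOn (outwardUnitNormal Ω) (frontier Ω) := by
  intro x hx
  obtain ⟨U, e, s, hxU, h⟩ := hΩ1.exists_isGraphChart hx
  have hgc : Continuous (gradient s) :=
    (LinearIsometryEquiv.continuous _).comp h.continuous_fderiv
  have hc : Continuous fun y => ‖gradient s y‖⁻¹ • gradient s y :=
    (hgc.norm.inv₀ fun y => (norm_pos_iff.2 (h.gradient_ne_zero y)).ne').smul hgc
  refine hc.continuousWithinAt.congr_of_eventuallyEq ?_
    (h.outwardUnitNormal_eq hxU ((h.mem_frontier_iff hΩ hxU).1 hx))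
  filter_upwards [self_mem_nhdsWithin, mem_nhdsWithin_of_mem_nhds (h.isOpen.mem_nhds hxU)]
    with y hy hyU
  exact h.outwardUnitNormal_eq hyU ((h.mem_frontier_iff hΩ hyU).1 hy)

/-- At a boundary point the directions pointing into `Ω` span the space, so derivatives within
`closure Ω` are unique. -/
theorem HasC1Boundary.uniqueDiffOn_closure (hΩ1 : HasC1Boundary Ω) (hΩ : IsOpen Ω) :
    UniqueDiffOn ℝ (closure Ω) := by
  intro x hx
  by_cases hxΩ : x ∈ Ω
  · exact (hΩ.uniqueDiffWithinAt hxΩ).mono subset_closure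
  have hxf : x ∈ frontier Ω := by
    rw [hΩ.frontier_eq]; exact ⟨hx, hxΩ⟩
  obtain ⟨U, e, s, hxU, h⟩ := hΩ1.exists_isGraphChart hxf
  obtain ⟨hn1, hin, -⟩ := h.isOutwardUnitNormal hxU ((h.mem_frontier_iff hΩ hxU).1 hxf)
  set n := ‖gradient s x‖⁻¹ • gradient s x
  have htan : ∀ v, ⟪v, n⟫_ℝ < 0 → v ∈ tangentConeAt ℝ (closure Ω) x := fun v hv =>
    mem_tangentConeAt_of_add_smul_mem (l := 𝓝[>] (0 : ℝ)) (c := id)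
      (tendsto_id.mono_left (nhdsWithin_mono 0 fun t (ht : 0 < t) => ht.ne'))
      ((hin v hv).mono fun t ht => subset_closure ht)
  refine ⟨?_, subset_closure hx⟩
  have htop : Submodule.span ℝ (tangentConeAt ℝ (closure Ω) x) = ⊤ := by
    refine Submodule.eq_top_iff'.2 fun u => ?_
    have e1 : u = (u - (|⟪u, n⟫_ℝ| + 1) • n) - (-((|⟪u, n⟫_ℝ| + 1) • n)) := by abel
    have hnn : ⟪n, n⟫_ℝ = 1 := by rw [real_inner_self_eq_norm_sq, hn1, one_pow]
    rw [e1]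
    refine Submodule.sub_mem _ (Submodule.subset_span (htan _ ?_))
      (Submodule.subset_span (htan _ ?_))
    · rw [inner_sub_left, real_inner_smul_left, hnn]
      linarith [le_abs_self ⟪u, n⟫_ℝ]
    · rw [inner_neg_left, real_inner_smul_left, hnn]
      linarith [abs_nonneg ⟪u, n⟫_ℝ]
  rw [htop]
  exact dense_univ

/-- The estimate of `IsGraphChart.exists_nhds_abs_integral_sub_le` near any point of the closure;
near interior points both integrals vanish. -/
theorem HasC1Boundary.exists_nhds_abs_integral_sub_le (hΩ1 : HasC1Boundary Ω) (hΩ : IsOpen Ω)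
    (hb : Bornology.IsBounded Ω) {x₀ : EuclideanSpace ℝ (Fin m)} (hx₀ : x₀ ∈ closure Ω)
    {δ : ℝ} (hδ : 0 < δ) : ∃ V, IsOpen V ∧ x₀ ∈ V ∧ boundaryArea Ω V < ⊤ ∧
      ∀ w : EuclideanSpace ℝ (Fin m) → ℝ, ContDiffOn ℝ 1 w (closure Ω) → tsupport w ⊆ V →
        ∀ v : EuclideanSpace ℝ (Fin m),
        |(∫ x in Ω, fderivWithin ℝ w (closure Ω) x v) -
            ∫ x, w x * ⟪v, outwardUnitNormal Ω x⟫_ℝ ∂(boundaryArea Ω)| ≤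
          δ * (‖v‖ * ∫ x, |w x| ∂(boundaryArea Ω)) := by
  by_cases hxΩ : x₀ ∈ Ω
  · have hdisj : ∀ x ∈ frontier Ω, x ∉ Ω := fun x hx => by
      rw [hΩ.frontier_eq] at hx; exact hx.2
    refine ⟨Ω, hΩ, hxΩ, ?_, fun w hw hsupp v => ?_⟩
    · rw [boundaryArea, Measure.restrict_apply hΩ.measurableSet,
        Set.disjoint_iff_inter_eq_empty.1 (Set.disjoint_right.2 hdisj), measure_empty]
      exact ENNReal.zero_lt_top
    have hw0 : ∀ x ∉ Ω, w =ᶠ[𝓝 x] 0 := fun x hx =>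
      notMem_tsupport_iff_eventuallyEq.1 fun h => hx (hsupp h)
    have hwd : ContDiff ℝ 1 w := contDiff_iff_contDiffAt.2 fun x => by
      by_cases hx : x ∈ Ω
      · exact hw.contDiffAt (mem_of_superset (hΩ.mem_nhds hx) subset_closure)
      · exact contDiffAt_const.congr_of_eventuallyEq (hw0 x hx)
    have hwc : HasCompactSupport w := HasCompactSupport.intro hb.isCompact_closure fun x hx =>
      (hw0 x fun h => hx (subset_closure h)).eq_of_nhds
    have I₁ : ∫ x in Ω, fderivWithin ℝ w (closure Ω) x v = 0 := by
      rw [setIntegral_congr_fun hΩ.measurableSet fun x hx => by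
        rw [fderivWithin_eq_fderiv_of_mem_open hΩ w hx],
        setIntegral_eq_integral_of_forall_compl_eq_zero fun x hx => by
          rw [(hw0 x hx).fderiv_eq]; simp [Pi.zero_def]]
      exact integral_fderiv_eq_zero_of_hasCompactSupport hwd hwc v
    have I₂ : ∫ x, w x * ⟪v, outwardUnitNormal Ω x⟫_ℝ ∂(boundaryArea Ω) = 0 := by
      rw [boundaryArea]
      refine setIntegral_eq_zero_of_forall_eq_zero fun x hx => ?_
      rw [(hw0 x (hdisj x hx)).eq_of_nhds, Pi.zero_apply, zero_mul]
    rw [I₁, I₂, sub_zero, abs_zero]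
    exact mul_nonneg hδ.le (mul_nonneg (norm_nonneg _) (integral_nonneg fun x => abs_nonneg _))
  · have hxf : x₀ ∈ frontier Ω := by
      rw [hΩ.frontier_eq]; exact ⟨hx₀, hxΩ⟩
    obtain ⟨U, e, s, hxU, h⟩ := hΩ1.exists_isGraphChart hxf
    obtain ⟨V, hVo, hxV, hfin, hV⟩ := h.exists_nhds_abs_integral_sub_le hΩ hb
      (hΩ1.uniqueDiffOn_closure hΩ) (fun y hy hs => h.outwardUnitNormal_eq hy hs) hxU hδ
    rw [finrank_euclideanSpace_fin] at hfin hV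
    refine ⟨V, hVo, hxV, ?_, hV⟩
    rwa [boundaryArea, Measure.restrict_apply hVo.measurableSet, Set.inter_comm]

theorem HasC1Boundary.isFiniteMeasure_boundaryArea (hΩ1 : HasC1Boundary Ω) (hΩ : IsOpen Ω)
    (hb : Bornology.IsBounded Ω) : IsFiniteMeasure (boundaryArea Ω) := by
  have hK : IsCompact (frontier Ω) :=
    hb.isCompact_closure.of_isClosed_subset isClosed_frontier frontier_subset_closure
  have h1 : boundaryArea Ω (frontier Ω) < ⊤ := hK.measure_lt_top_of_nhdsWithin fun x hx => by
    obtain ⟨V, hVo, hxV, hfin, -⟩ :=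
      hΩ1.exists_nhds_abs_integral_sub_le hΩ hb (frontier_subset_closure hx) one_pos
    exact ⟨V, mem_nhdsWithin_of_mem_nhds (hVo.mem_nhds hxV), hfin⟩
  refine ⟨?_⟩
  rw [boundaryArea, Measure.restrict_apply_univ]
  rwa [boundaryArea, Measure.restrict_apply_self] at h1

theorem HasC1Boundary.integrable_boundaryArea (hΩ1 : HasC1Boundary Ω) (hΩ : IsOpen Ω)
    (hb : Bornology.IsBounded Ω) {g : EuclideanSpace ℝ (Fin m) → ℝ}
    (hg : ContinuousOn g (frontier Ω)) : Integrable g (boundaryArea Ω) := by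
  have := hΩ1.isFiniteMeasure_boundaryArea hΩ hb
  have hK : IsCompact (frontier Ω) :=
    hb.isCompact_closure.of_isClosed_subset isClosed_frontier frontier_subset_closure
  have h := hg.integrableOn_compact (μ := boundaryArea Ω) hK
  rwa [IntegrableOn, boundaryArea, Measure.restrict_restrict_of_subset subset_rfl] at h

open scoped Manifold in
/-- A finite smooth partition of unity on a compact set, subordinate to prescribed open
neighbourhoods of its points. -/
theorem exists_finite_smooth_partition {E : Type*} [NormedAddCommGroup E] [InnerProductSpace ℝ E]
    [FiniteDimensional ℝ E] {K : Set E} (hK : IsCompact K) {V : K → Set E}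
    (hVo : ∀ i, IsOpen (V i)) (hVm : ∀ i : K, (i : E) ∈ V i) :
    ∃ (F : Finset K) (ρ : K → E → ℝ), (∀ i, ContDiff ℝ 1 (ρ i)) ∧ (∀ i x, 0 ≤ ρ i x) ∧
      (∀ i, tsupport (ρ i) ⊆ V i) ∧ ∀ x ∈ K, ∑ i ∈ F, ρ i x = 1 := by
  obtain ⟨f, hf⟩ := SmoothPartitionOfUnity.exists_isSubordinate 𝓘(ℝ, E) hK.isClosed V hVo
    (fun x hx => Set.mem_iUnion.2 ⟨⟨x, hx⟩, hVm ⟨x, hx⟩⟩)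
  have hfin := f.locallyFinite.finite_nonempty_inter_compact hK
  refine ⟨hfin.toFinset, fun i => f i, fun i => ?_, fun i x => f.nonneg i x, fun i => hf i,
    fun x hx => ?_⟩
  · exact ((f i).contMDiff.contDiff).of_le (by exact_mod_cast le_top)
  · rw [← finsum_eq_sum_of_support_subset (s := hfin.toFinset) (fun i => f i x), f.sum_eq_one hx]
    intro i hi
    rw [Set.Finite.coe_toFinset]
    exact ⟨x, hi, hx⟩

/-- **Gauss-Green formula**: on a bounded open set with `C¹` boundary, the integral of a directional
derivative of a function that is `C¹` up to the boundary is its flux through the boundary. -/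
theorem HasC1Boundary.integral_fderivWithin (hΩ1 : HasC1Boundary Ω) (hΩ : IsOpen Ω)
    (hb : Bornology.IsBounded Ω) {w : EuclideanSpace ℝ (Fin m) → ℝ}
    (hw : ContDiffOn ℝ 1 w (closure Ω)) (v : EuclideanSpace ℝ (Fin m)) :
    ∫ x in Ω, fderivWithin ℝ w (closure Ω) x v =
      ∫ x, w x * ⟪v, outwardUnitNormal Ω x⟫_ℝ ∂(boundaryArea Ω) := by
  have hK := hb.isCompact_closure
  have hud := hΩ1.uniqueDiffOn_closure hΩ
  have hn := hΩ1.continuousOn_outwardUnitNormal hΩ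
  have hnn : 0 ≤ ‖v‖ * ∫ x, |w x| ∂(boundaryArea Ω) :=
    mul_nonneg (norm_nonneg _) (integral_nonneg fun x => abs_nonneg _)
  have key : ∀ δ > 0, |(∫ x in Ω, fderivWithin ℝ w (closure Ω) x v) -
      ∫ x, w x * ⟪v, outwardUnitNormal Ω x⟫_ℝ ∂(boundaryArea Ω)| ≤
      δ * (‖v‖ * ∫ x, |w x| ∂(boundaryArea Ω)) := by
    intro δ hδ
    choose V hVo hVm _ hV using fun i : closure Ω =>
      hΩ1.exists_nhds_abs_integral_sub_le hΩ hb i.2 hδ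
    obtain ⟨F, ρ, hρd, hρ0, hρV, hρ1⟩ := exists_finite_smooth_partition hK hVo hVm
    have hwi : ∀ i, ContDiffOn ℝ 1 (fun x => ρ i x * w x) (closure Ω) := fun i =>
      (hρd i).contDiffOn.mul hw
    have hwb : ∀ i, ContinuousOn (fun x => ρ i x * w x) (frontier Ω) := fun i =>
      (hwi i).continuousOn.mono frontier_subset_closure
    have hsum : ∀ x ∈ closure Ω, w x = ∑ i ∈ F, ρ i x * w x := fun x hx => by
      rw [← Finset.sum_mul, hρ1 x hx, one_mul]
    have I₁ : ∫ x in Ω, fderivWithin ℝ w (closure Ω) x v =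
        ∑ i ∈ F, ∫ x in Ω, fderivWithin ℝ (fun x => ρ i x * w x) (closure Ω) x v := by
      rw [← integral_finsetSum]
      · refine setIntegral_congr_fun hΩ.measurableSet fun x hx => ?_
        have hxc := subset_closure hx
        beta_reduce
        rw [fderivWithin_congr hsum (hsum x hxc), fderivWithin_fun_sum (hud x hxc) fun i _ =>
          (hwi i).differentiableOn one_ne_zero x hxc, _root_.sum_apply]
      · intro i _
        exact (ContinuousOn.integrableOn_compact hK (((hwi i).continuousOn_fderivWithin hud
          le_rfl).clm_apply continuousOn_const)).mono_set subset_closure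
    have I₂ : ∫ x, w x * ⟪v, outwardUnitNormal Ω x⟫_ℝ ∂(boundaryArea Ω) =
        ∑ i ∈ F, ∫ x, (ρ i x * w x) * ⟪v, outwardUnitNormal Ω x⟫_ℝ ∂(boundaryArea Ω) := by
      rw [← integral_finsetSum]
      · refine setIntegral_congr_fun isClosed_frontier.measurableSet fun x hx => ?_
        rw [← Finset.sum_mul, ← hsum x (frontier_subset_closure hx)]
      · exact fun i _ => hΩ1.integrable_boundaryArea hΩ hb
          ((hwb i).mul (continuousOn_const.inner hn))
    have I₃ : ∫ x, |w x| ∂(boundaryArea Ω) = ∑ i ∈ F, ∫ x, |ρ i x * w x| ∂(boundaryArea Ω) := by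
      rw [← integral_finsetSum]
      · refine setIntegral_congr_fun isClosed_frontier.measurableSet fun x hx => ?_
        simp_rw [abs_mul, fun i => abs_of_nonneg (hρ0 i x)]
        rw [← Finset.sum_mul, hρ1 x (frontier_subset_closure hx), one_mul]
      · exact fun i _ => (hΩ1.integrable_boundaryArea hΩ hb (hwb i)).abs
    rw [I₁, I₂, I₃, ← Finset.sum_sub_distrib, Finset.mul_sum, Finset.mul_sum]
    exact (Finset.abs_sum_le_sum_abs _ _).trans (Finset.sum_le_sum fun i _ =>
      hV i _ (hwi i) ((tsupport_mul_subset_left).trans (hρV i)) v)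
  rw [← sub_eq_zero, ← abs_nonpos_iff]
  refine le_of_forall_pos_le_add fun ε hε => ?_
  rw [zero_add]
  set C := ‖v‖ * ∫ x, |w x| ∂(boundaryArea Ω)
  refine (key (ε / (C + 1)) (by positivity)).trans ?_
  rw [div_mul_eq_mul_div, div_le_iff₀ (by positivity)]
  nlinarith

end GaussGreen

/-! ### Harmonic polynomials on the sphere -/

section Harmonic

variable {m : ℕ}

/-- Evaluation of a polynomial in `m` variables at a point of Euclidean space. -/
noncomputable abbrev polyEval (u : EuclideanSpace ℝ (Fin m)) : MvPolynomial (Fin m) ℝ →+* ℝ :=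
  MvPolynomial.eval fun i => u i

theorem contDiff_polyEval (p : MvPolynomial (Fin m) ℝ) {n : WithTop ℕ∞} :
    ContDiff ℝ n fun u : EuclideanSpace ℝ (Fin m) => polyEval u p := by
  induction p using MvPolynomial.induction_on with
  | C a => simpa using contDiff_const
  | add p q hp hq => simpa using hp.add hq
  | mul_X p i hp =>
    simpa using hp.mul (EuclideanSpace.proj i : EuclideanSpace ℝ (Fin m) →L[ℝ] ℝ).contDiff

theorem continuous_polyEval (p : MvPolynomial (Fin m) ℝ) :
    Continuous fun u : EuclideanSpace ℝ (Fin m) => polyEval u p :=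
  (contDiff_polyEval p (n := 0)).continuous

theorem fderiv_polyEval (p : MvPolynomial (Fin m) ℝ) (u : EuclideanSpace ℝ (Fin m)) (j : Fin m) :
    fderiv ℝ (fun u : EuclideanSpace ℝ (Fin m) => polyEval u p) u (EuclideanSpace.single j 1) =
      polyEval u (MvPolynomial.pderiv j p) := by
  have hd : ∀ p : MvPolynomial (Fin m) ℝ,
      DifferentiableAt ℝ (fun u : EuclideanSpace ℝ (Fin m) => polyEval u p) u := fun p =>
    (contDiff_polyEval p).differentiable one_ne_zero u
  induction p using MvPolynomial.induction_on with
  | C a => simp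
  | add p q hp hq =>
    simp only [map_add] at hp hq ⊢
    rw [fderiv_fun_add (hd p) (hd q), _root_.add_apply, hp, hq]
  | mul_X p i hp =>
    have hX : HasFDerivAt (fun u : EuclideanSpace ℝ (Fin m) => u i)
        (EuclideanSpace.proj i : EuclideanSpace ℝ (Fin m) →L[ℝ] ℝ) u :=
      (EuclideanSpace.proj i : EuclideanSpace ℝ (Fin m) →L[ℝ] ℝ).hasFDerivAt
    simp only [map_mul, MvPolynomial.eval_X] at hp ⊢
    rw [((hd p).hasFDerivAt.fun_mul hX).fderiv]
    simp only [_root_.add_apply, _root_.smul_apply, smul_eq_mul, hp, Derivation.leibniz,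
      MvPolynomial.pderiv_X, map_add, map_mul, MvPolynomial.eval_X, Pi.single_apply, apply_ite,
      map_one, map_zero]
    simp [eq_comm]

theorem MvPolynomial.IsHomogeneous.polyEval_smul {p : MvPolynomial (Fin m) ℝ} {k : ℕ}
    (hp : p.IsHomogeneous k) (r : ℝ) (u : EuclideanSpace ℝ (Fin m)) :
    polyEval (r • u) p = r ^ k * polyEval u p := by
  rw [polyEval, polyEval, MvPolynomial.eval_eq', MvPolynomial.eval_eq', Finset.mul_sum]
  refine Finset.sum_congr rfl fun d hd => ?_
  have hdeg : ∑ i, d i = k := by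
    have := hp (MvPolynomial.mem_support_iff.1 hd)
    rw [Finsupp.weight_apply, Finsupp.sum_fintype _ _ (by simp)] at this
    simpa using this
  simp only [PiLp.smul_apply, smul_eq_mul, mul_pow, Finset.prod_mul_distrib,
    Finset.prod_pow_eq_pow_sum, hdeg]
  ring

/-- Integration of polynomials over the unit sphere. -/
noncomputable def sphereIntegral (m : ℕ) : MvPolynomial (Fin m) ℝ →ₗ[ℝ] ℝ where
  toFun p := ∫ u : sphere (0 : EuclideanSpace ℝ (Fin m)) 1, polyEval (u : _) p ∂(sphereArea m)
  map_add' p q := by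
    have hi : ∀ p : MvPolynomial (Fin m) ℝ, Integrable
        (fun u : sphere (0 : EuclideanSpace ℝ (Fin m)) 1 =>
          polyEval (u : EuclideanSpace ℝ (Fin m)) p) (sphereArea m) := fun p =>
      have : IsFiniteMeasure (sphereArea m) := by unfold sphereArea; infer_instance
      ((continuous_polyEval p).comp continuous_subtype_val).integrable_of_hasCompactSupport
        (HasCompactSupport.of_compactSpace _)
    simp only [map_add]
    exact integral_add (hi p) (hi q)
  map_smul' c p := by
    simp only [MvPolynomial.smul_eval, RingHom.id_apply, smul_eq_mul]
    exact integral_const_mul _ _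

instance : IsFiniteMeasure (sphereArea m) := by unfold sphereArea; infer_instance

theorem integrable_polyEval_sphere (p : MvPolynomial (Fin m) ℝ) :
    Integrable (fun u : sphere (0 : EuclideanSpace ℝ (Fin m)) 1 =>
      polyEval (u : EuclideanSpace ℝ (Fin m)) p) (sphereArea m) :=
  ((continuous_polyEval p).comp continuous_subtype_val).integrable_of_hasCompactSupport
    (HasCompactSupport.of_compactSpace _)

theorem sphereIntegral_apply (p : MvPolynomial (Fin m) ℝ) : sphereIntegral m p =
    ∫ u : sphere (0 : EuclideanSpace ℝ (Fin m)) 1, polyEval (u : EuclideanSpace ℝ (Fin m)) p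
      ∂(sphereArea m) := rfl

/-- Integration in polar coordinates of a function that separates into a radial and an angular
factor. -/
theorem integral_eq_sphere_mul_radial {F : EuclideanSpace ℝ (Fin m) → ℝ}
    {a : sphere (0 : EuclideanSpace ℝ (Fin m)) 1 → ℝ} {b : ℝ → ℝ}
    (h : ∀ (u : sphere (0 : EuclideanSpace ℝ (Fin m)) 1) (r : ℝ), 0 < r →
      F (r • (u : EuclideanSpace ℝ (Fin m))) = a u * b r) (hm : 0 < m) :
    ∫ x, F x = (∫ u, a u ∂(sphereArea m)) *
      ∫ r : Set.Ioi (0 : ℝ), b r ∂(Measure.volumeIoiPow (m - 1)) := by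
  have : Nonempty (Fin m) := ⟨⟨0, hm⟩⟩
  have hmp := (volume : Measure (EuclideanSpace ℝ (Fin m))).measurePreserving_homeomorphUnitSphereProd
  rw [finrank_euclideanSpace_fin] at hmp
  calc ∫ x, F x = ∫ x in {(0 : EuclideanSpace ℝ (Fin m))}ᶜ, F x := by
        rw [restrict_compl_singleton]
    _ = ∫ x : ({0}ᶜ : Set (EuclideanSpace ℝ (Fin m))), F x ∂(volume.comap Subtype.val) :=
        (integral_subtype_comap (measurableSet_singleton _).compl F).symm
    _ = ∫ x : ({0}ᶜ : Set (EuclideanSpace ℝ (Fin m))),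
          (fun q : sphere (0 : EuclideanSpace ℝ (Fin m)) 1 × Set.Ioi (0 : ℝ) => a q.1 * b q.2)
            (homeomorphUnitSphereProd _ x) ∂(volume.comap Subtype.val) := by
        refine integral_congr_ae (ae_of_all _ fun x => ?_)
        beta_reduce
        rw [← h _ _ (homeomorphUnitSphereProd _ x).2.2]
        congr 1
        have hx : ‖(x : EuclideanSpace ℝ (Fin m))‖ ≠ 0 := norm_ne_zero_iff.2 x.2
        simp [smul_smul, hx]
    _ = ∫ q, a q.1 * b q.2 ∂((sphereArea m).prod (Measure.volumeIoiPow (m - 1))) :=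
        hmp.integral_comp (Homeomorph.measurableEmbedding _) fun q => a q.1 * b q.2
    _ = _ := integral_prod_mul a fun r : Set.Ioi (0 : ℝ) => b r

theorem hasDerivAt_max_zero_sq (t : ℝ) :
    HasDerivAt (fun t : ℝ => max t 0 ^ 2) (2 * max t 0) t := by
  refine hasDerivAt_of_hasDerivAt_of_ne' (x := 0) (g := fun t => 2 * max t 0) (fun y hy => ?_)
    (by fun_prop) (by fun_prop) t
  rcases lt_or_gt_of_ne hy with hy | hy
  · have : (fun t : ℝ => max t 0 ^ 2) =ᶠ[𝓝 y] fun _ => 0 := by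
      filter_upwards [gt_mem_nhds hy] with x hx
      rw [max_eq_right (le_of_lt hx)]; norm_num
    rw [max_eq_right hy.le, mul_zero]
    exact (hasDerivAt_const y (0 : ℝ)).congr_of_eventuallyEq this
  · have : (fun t : ℝ => max t 0 ^ 2) =ᶠ[𝓝 y] fun t => t ^ 2 := by
      filter_upwards [lt_mem_nhds hy] with x hx
      rw [max_eq_left (le_of_lt hx)]
    rw [max_eq_left hy.le]
    simpa using (hasDerivAt_pow 2 y).congr_of_eventuallyEq this

/-- Integrating the divergence of `(1 - |u|²)₊² R` for a divergence-free field `R` makes a radial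
weight times the radial component of `R` integrate to `0`. This replaces the divergence theorem on
the ball. -/
theorem integral_cutoff_mul_eq_zero (R : Fin m → MvPolynomial (Fin m) ℝ)
    (hR : ∑ j, MvPolynomial.pderiv j (R j) = 0) :
    ∫ u : EuclideanSpace ℝ (Fin m), max (1 - ‖u‖ ^ 2) 0 *
      polyEval u (∑ j, MvPolynomial.X j * R j) = 0 := by
  set θ : EuclideanSpace ℝ (Fin m) → ℝ := fun u => max (1 - ‖u‖ ^ 2) 0 with hθ
  have hθc : Continuous θ := by fun_prop
  have hθ0 : ∀ u, u ∉ closedBall (0 : EuclideanSpace ℝ (Fin m)) 1 → θ u = 0 := fun u hu => by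
    rw [mem_closedBall_zero_iff, not_le] at hu
    exact max_eq_right (by nlinarith)
  have hχ : ContDiff ℝ 1 fun t : ℝ => max t 0 ^ 2 := by
    rw [contDiff_one_iff_deriv]
    refine ⟨fun t => (hasDerivAt_max_zero_sq t).differentiableAt, ?_⟩
    rw [funext fun t => (hasDerivAt_max_zero_sq t).deriv]
    fun_prop
  have hψ : ContDiff ℝ 1 fun u => θ u ^ 2 :=
    hχ.comp (contDiff_const.sub (contDiff_norm_sq ℝ))
  have hψd : ∀ u j, fderiv ℝ (fun u => θ u ^ 2) u (EuclideanSpace.single j 1) =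
      -4 * θ u * u j := by
    intro u j
    have h1 : HasFDerivAt (fun u : EuclideanSpace ℝ (Fin m) => 1 - ‖u‖ ^ 2)
        (-((2 : ℝ) • innerSL ℝ u)) u := by
      rw [ofNat_smul_eq_nsmul]
      exact (hasStrictFDerivAt_norm_sq u).hasFDerivAt.const_sub 1
    have h2 : HasFDerivAt (fun u => θ u ^ 2) ((2 * θ u) • (-((2 : ℝ) • innerSL ℝ u))) u :=
      (hasDerivAt_max_zero_sq _).comp_hasFDerivAt u h1
    rw [h2.fderiv]
    simp only [_root_.smul_apply, _root_.neg_apply, innerSL_apply_apply, smul_eq_mul,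
      EuclideanSpace.inner_single_right]
    simp
    ring
  have hint : ∀ p : MvPolynomial (Fin m) ℝ, ∀ f : EuclideanSpace ℝ (Fin m) → ℝ, Continuous f →
      (∀ u, u ∉ closedBall (0 : EuclideanSpace ℝ (Fin m)) 1 → f u = 0) →
      Integrable fun u : EuclideanSpace ℝ (Fin m) => f u * polyEval u p := fun p f hf hf0 =>
    (hf.mul (continuous_polyEval p)).integrable_of_hasCompactSupport
      (HasCompactSupport.intro (isCompact_closedBall 0 1) fun u hu => by simp [hf0 u hu])
  have hj : ∀ j, ∫ u, (-4 * (θ u * polyEval u (MvPolynomial.X j * R j)) +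
      θ u ^ 2 * polyEval u (MvPolynomial.pderiv j (R j))) = 0 := by
    intro j
    rw [← integral_fderiv_eq_zero_of_hasCompactSupport
      (hψ.mul (contDiff_polyEval (R j)))
      (HasCompactSupport.intro (isCompact_closedBall 0 1) fun u hu => by simp [hθ0 u hu])
      (EuclideanSpace.single j 1)]
    refine integral_congr_ae (ae_of_all _ fun u => ?_)
    have hd := ((hψ.differentiable one_ne_zero u).hasFDerivAt.fun_mul
      ((contDiff_polyEval (R j)).differentiable one_ne_zero u).hasFDerivAt).fderiv
    beta_reduce
    rw [hd]
    simp only [_root_.add_apply, _root_.smul_apply, smul_eq_mul, hψd, fderiv_polyEval, map_mul,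
      MvPolynomial.eval_X]
    ring
  have hsum : ∑ j, ∫ u, (-4 * (θ u * polyEval u (MvPolynomial.X j * R j)) +
      θ u ^ 2 * polyEval u (MvPolynomial.pderiv j (R j))) = 0 :=
    Finset.sum_eq_zero fun j _ => hj j
  rw [← integral_finsetSum] at hsum
  · have he : ∀ u, ∑ j, (-4 * (θ u * polyEval u (MvPolynomial.X j * R j)) +
        θ u ^ 2 * polyEval u (MvPolynomial.pderiv j (R j))) =
        -4 * (θ u * polyEval u (∑ j, MvPolynomial.X j * R j)) := by
      intro u
      rw [Finset.sum_add_distrib, ← Finset.mul_sum, ← Finset.mul_sum, ← Finset.mul_sum, ← map_sum,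
        ← map_sum, hR, map_zero, mul_zero, add_zero]
    simp_rw [he] at hsum
    rw [integral_const_mul] at hsum
    simpa using hsum
  · exact fun j _ => ((hint _ θ hθc hθ0).const_mul _).add
      (hint _ _ (hθc.pow 2) fun u hu => by simp [hθ0 u hu])

/-- Harmonic homogeneous polynomials of different degrees are orthogonal on the sphere. The field
`q ∇p - p ∇q` is divergence free, and its radial component is `(k - l) p q`. -/
theorem sphereIntegral_mul_eq_zero {k l : ℕ} (hkl : k ≠ l) {p q : MvPolynomial (Fin m) ℝ}
    (hp : p ∈ harmonicPolynomials m k) (hq : q ∈ harmonicPolynomials m l) :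
    sphereIntegral m (p * q) = 0 := by
  rcases Nat.eq_zero_or_pos m with rfl | hm
  · rw [sphereIntegral_apply]
    have : IsEmpty (sphere (0 : EuclideanSpace ℝ (Fin 0)) 1) :=
      ⟨fun u => by
        have h1 := mem_sphere_zero_iff_norm.1 u.2
        rw [Subsingleton.elim (u : EuclideanSpace ℝ (Fin 0)) 0, norm_zero] at h1
        exact zero_ne_one h1⟩
    exact integral_of_isEmpty
  have h1 := integral_cutoff_mul_eq_zero
    (fun j => q * MvPolynomial.pderiv j p - p * MvPolynomial.pderiv j q) (by
      simp only [map_sub, Derivation.leibniz, smul_eq_mul, add_sub_add_comm,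
        Finset.sum_add_distrib, Finset.sum_sub_distrib, ← Finset.mul_sum, hp.2, hq.2]
      rw [sub_eq_zero.2 (by simp : q * (0 : MvPolynomial (Fin m) ℝ) = p * 0), zero_add,
        sub_eq_zero]
      exact Finset.sum_congr rfl fun j _ => mul_comm _ _)
  have h2 : ∑ j, MvPolynomial.X j * (q * MvPolynomial.pderiv j p - p * MvPolynomial.pderiv j q) =
      ((k : ℝ) - l) • (p * q) := by
    have e1 := hp.1.sum_X_mul_pderiv
    have e2 := hq.1.sum_X_mul_pderiv
    calc _ = q * ∑ j, MvPolynomial.X j * MvPolynomial.pderiv j p -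
          p * ∑ j, MvPolynomial.X j * MvPolynomial.pderiv j q := by
          rw [Finset.mul_sum, Finset.mul_sum, ← Finset.sum_sub_distrib]
          exact Finset.sum_congr rfl fun j _ => by ring
      _ = _ := by
          rw [e1, e2, sub_smul, Nat.cast_smul_eq_nsmul, Nat.cast_smul_eq_nsmul, mul_smul_comm,
            mul_smul_comm, mul_comm q p]
  rw [h2] at h1
  have h3 : ∫ u : EuclideanSpace ℝ (Fin m), max (1 - ‖u‖ ^ 2) 0 *
      polyEval u (((k : ℝ) - l) • (p * q)) = (((k : ℝ) - l) * sphereIntegral m (p * q)) *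
      ∫ r : Set.Ioi (0 : ℝ), max (1 - (r : ℝ) ^ 2) 0 * (r : ℝ) ^ (k + l)
        ∂(Measure.volumeIoiPow (m - 1)) := by
    have hconst : ((k : ℝ) - l) * sphereIntegral m (p * q) =
        ∫ u : sphere (0 : EuclideanSpace ℝ (Fin m)) 1, ((k : ℝ) - l) *
          polyEval (u : EuclideanSpace ℝ (Fin m)) (p * q) ∂(sphereArea m) :=
      (integral_const_mul _ _).symm
    rw [hconst]
    refine integral_eq_sphere_mul_radial (b := fun r => max (1 - r ^ 2) 0 * r ^ (k + l))
      (fun u r hr => ?_) hm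
    rw [norm_smul, mem_sphere_zero_iff_norm.1 u.2, mul_one, Real.norm_eq_abs, sq_abs,
      MvPolynomial.smul_eval, (hp.1.mul hq.1).polyEval_smul]
    ring
  have h4 : ∫ u : EuclideanSpace ℝ (Fin m), max (1 - ‖u‖ ^ 2) 0 * ‖u‖ ^ (k + l) =
      (∫ _ : sphere (0 : EuclideanSpace ℝ (Fin m)) 1, (1 : ℝ) ∂(sphereArea m)) *
      ∫ r : Set.Ioi (0 : ℝ), max (1 - (r : ℝ) ^ 2) 0 * (r : ℝ) ^ (k + l)
        ∂(Measure.volumeIoiPow (m - 1)) := by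
    refine integral_eq_sphere_mul_radial (b := fun r => max (1 - r ^ 2) 0 * r ^ (k + l))
      (fun u r hr => ?_) hm
    rw [norm_smul, mem_sphere_zero_iff_norm.1 u.2, mul_one, Real.norm_eq_abs, abs_of_pos hr,
      one_mul]
  have h5 : 0 < ∫ u : EuclideanSpace ℝ (Fin m), max (1 - ‖u‖ ^ 2) 0 * ‖u‖ ^ (k + l) := by
    refine Continuous.integral_pos_of_hasCompactSupport_nonneg_nonzero
      (x := EuclideanSpace.single ⟨0, hm⟩ (1 / 2)) (by fun_prop)
      (HasCompactSupport.intro (isCompact_closedBall 0 1) fun u hu => ?_)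
      (fun u => mul_nonneg (le_max_right _ _) (by positivity)) ?_
    · rw [mem_closedBall_zero_iff, not_le] at hu
      rw [max_eq_right (by nlinarith), zero_mul]
    · rw [PiLp.norm_single]
      norm_num
  have h6 := right_ne_zero_of_mul (h4 ▸ h5.ne')
  rw [h3] at h1
  have h7 := (mul_eq_zero.1 h1).resolve_right h6
  exact (mul_eq_zero.1 h7).resolve_left (sub_ne_zero.2 (by exact_mod_cast hkl))

end Harmonic

section HarmonicIdentities

variable {m : ℕ}

theorem MvPolynomial.pderiv_comm (i j : Fin m) (p : MvPolynomial (Fin m) ℝ) :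
    pderiv i (pderiv j p) = pderiv j (pderiv i p) := by
  have h : ⁅pderiv (R := ℝ) i, pderiv (R := ℝ) j⁆ = 0 := by
    ext k
    simp [Derivation.commutator_apply, pderiv_X, Pi.single_apply, apply_ite]
  have := congrArg (fun D => D p) h
  simpa [Derivation.commutator_apply, sub_eq_zero] using this

theorem pderiv_mem_harmonicPolynomials {k : ℕ} {p : MvPolynomial (Fin m) ℝ}
    (hp : p ∈ harmonicPolynomials m k) (j : Fin m) :
    MvPolynomial.pderiv j p ∈ harmonicPolynomials m (k - 1) := by
  refine ⟨hp.1.pderiv, ?_⟩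
  have : ∀ i, MvPolynomial.pderiv i (MvPolynomial.pderiv i (MvPolynomial.pderiv j p)) =
      MvPolynomial.pderiv j (MvPolynomial.pderiv i (MvPolynomial.pderiv i p)) := fun i => by
    rw [MvPolynomial.pderiv_comm i j p, MvPolynomial.pderiv_comm i j]
  simp_rw [this]
  rw [← map_sum, hp.2, map_zero]

theorem pderiv_eq_zero_of_isHomogeneous_zero {p : MvPolynomial (Fin m) ℝ}
    (hp : p.IsHomogeneous 0) (j : Fin m) : MvPolynomial.pderiv j p = 0 := by
  rw [← MvPolynomial.totalDegree_zero_iff_isHomogeneous,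
    MvPolynomial.totalDegree_eq_zero_iff_eq_C] at hp
  rw [hp, MvPolynomial.pderiv_C]

/-- The Laplacian of `X_l q` is `2 ∂_l q` for a harmonic polynomial `q`. -/
theorem laplacian_X_mul (l : Fin m) {q : MvPolynomial (Fin m) ℝ}
    (hq : ∑ i, MvPolynomial.pderiv i (MvPolynomial.pderiv i q) = 0) :
    ∑ i, MvPolynomial.pderiv i (MvPolynomial.pderiv i (MvPolynomial.X l * q)) =
      2 * MvPolynomial.pderiv l q := by
  have h : ∀ i, MvPolynomial.pderiv i (MvPolynomial.pderiv i (MvPolynomial.X l * q)) =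
      MvPolynomial.X l * MvPolynomial.pderiv i (MvPolynomial.pderiv i q) +
        if l = i then 2 * MvPolynomial.pderiv i q else 0 := by
    intro i
    rcases eq_or_ne l i with rfl | hli
    · simp
      ring
    · simp [MvPolynomial.pderiv_X_of_ne hli, hli]
  simp_rw [h]
  rw [Finset.sum_add_distrib, ← Finset.mul_sum, hq, mul_zero, zero_add, Finset.sum_ite_eq]
  simp

/-- The Laplacian of `|X|² r` is `2 (m + 2 k) r` for a harmonic polynomial `r`, homogeneous of
degree `k`. -/
theorem laplacian_normSq_mul {k : ℕ} {r : MvPolynomial (Fin m) ℝ}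
    (hr : r ∈ harmonicPolynomials m k) :
    ∑ i, MvPolynomial.pderiv i (MvPolynomial.pderiv i ((∑ j, MvPolynomial.X j ^ 2) * r)) =
      MvPolynomial.C (2 * ((m : ℝ) + 2 * k)) * r := by
  set N : MvPolynomial (Fin m) ℝ := ∑ j, MvPolynomial.X j ^ 2 with hN
  have hNi : ∀ i, MvPolynomial.pderiv i N = 2 * MvPolynomial.X i := by
    intro i
    rw [hN, map_sum, Finset.sum_eq_single i]
    · simp
    · intro j _ hj
      simp [MvPolynomial.pderiv_X_of_ne hj]
    · simp
  have h2 : ∀ i : Fin m, MvPolynomial.pderiv i (2 : MvPolynomial (Fin m) ℝ) = 0 := fun i => by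
    have : (2 : MvPolynomial (Fin m) ℝ) = MvPolynomial.C 2 := (map_ofNat MvPolynomial.C 2).symm
    rw [this, MvPolynomial.pderiv_C]
  have h : ∀ i, MvPolynomial.pderiv i (MvPolynomial.pderiv i (N * r)) =
      2 * r + 4 * (MvPolynomial.X i * MvPolynomial.pderiv i r) +
        N * MvPolynomial.pderiv i (MvPolynomial.pderiv i r) := by
    intro i
    simp only [MvPolynomial.pderiv_mul, map_add, hNi, h2, MvPolynomial.pderiv_X_self]
    ring
  simp_rw [h]
  rw [Finset.sum_add_distrib, Finset.sum_add_distrib, ← Finset.mul_sum, ← Finset.mul_sum,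
    ← Finset.mul_sum, hr.2, hr.1.sum_X_mul_pderiv]
  simp only [Finset.sum_const, Finset.card_univ, Fintype.card_fin, nsmul_eq_mul, map_mul, map_add,
    map_natCast, map_ofNat]
  ring

theorem polyEval_normSq (u : sphere (0 : EuclideanSpace ℝ (Fin m)) 1) :
    polyEval (u : EuclideanSpace ℝ (Fin m)) (∑ j, MvPolynomial.X j ^ 2) = 1 := by
  have h := mem_sphere_zero_iff_norm.1 u.2
  have h2 := EuclideanSpace.real_norm_sq_eq (u : EuclideanSpace ℝ (Fin m))
  rw [h, one_pow] at h2
  simp [h2]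

/-- On the sphere, `X_l q` and `∂_l q / (m + 2 k)` differ by a harmonic polynomial of degree
`k + 2`, which is orthogonal to `h`. -/
theorem sphereIntegral_mul_X_mul {k : ℕ} {h q : MvPolynomial (Fin m) ℝ}
    (hh : h ∈ harmonicPolynomials m k) (hq : q ∈ harmonicPolynomials m (k + 1)) (l : Fin m) :
    sphereIntegral m (h * (MvPolynomial.X l * q)) =
      ((m : ℝ) + 2 * k)⁻¹ * sphereIntegral m (h * MvPolynomial.pderiv l q) := by
  have hm : (0 : ℝ) < m := by exact_mod_cast (Fin.pos l)
  have hc : (m : ℝ) + 2 * k ≠ 0 := by positivity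
  set c : ℝ := (m : ℝ) + 2 * k with hcdef
  set N : MvPolynomial (Fin m) ℝ := ∑ j, MvPolynomial.X j ^ 2 with hN
  have hr : MvPolynomial.pderiv l q ∈ harmonicPolynomials m k := by
    simpa using pderiv_mem_harmonicPolynomials hq l
  have hNhom : N.IsHomogeneous 2 := MvPolynomial.IsHomogeneous.sum _ _ _ fun j _ =>
    (MvPolynomial.isHomogeneous_X ℝ j).pow 2
  set T := MvPolynomial.X l * q - MvPolynomial.C c⁻¹ * (N * MvPolynomial.pderiv l q) with hT
  have hTmem : T ∈ harmonicPolynomials m (k + 2) := by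
    constructor
    · refine MvPolynomial.IsHomogeneous.sub ?_ ?_
      · have := (MvPolynomial.isHomogeneous_X ℝ l).mul hq.1
        rwa [show 1 + (k + 1) = k + 2 by ring] at this
      · have := (MvPolynomial.isHomogeneous_C (Fin m) c⁻¹).mul (hNhom.mul hr.1)
        rwa [show 0 + (2 + k) = k + 2 by ring] at this
    · simp only [hT, map_sub, MvPolynomial.pderiv_C_mul, Finset.sum_sub_distrib, ← Finset.mul_sum]
      rw [laplacian_X_mul l hq.2, laplacian_normSq_mul hr, ← mul_assoc, ← MvPolynomial.C_mul,
        ← hcdef, show c⁻¹ * (2 * c) = 2 by field_simp, map_ofNat, sub_self]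
  have h0 := sphereIntegral_mul_eq_zero (show k ≠ k + 2 by omega) hh hTmem
  have h1 : h * T = h * (MvPolynomial.X l * q) -
      c⁻¹ • (h * (N * MvPolynomial.pderiv l q)) := by
    rw [hT, MvPolynomial.smul_eq_C_mul]
    ring
  rw [h1, map_sub, map_smul, sub_eq_zero, smul_eq_mul] at h0
  rw [h0]
  congr 1
  rw [sphereIntegral_apply, sphereIntegral_apply]
  refine integral_congr_ae (ae_of_all _ fun u => ?_)
  beta_reduce
  rw [map_mul, map_mul, polyEval_normSq, one_mul, map_mul]

/-- For `k = 0` both sides vanish, so the sign or vanishing of `m + 2 k - 2` plays no role. -/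
theorem sphereIntegral_pderiv_mul_X_mul {k : ℕ} {p q : MvPolynomial (Fin m) ℝ}
    (hp : p ∈ harmonicPolynomials m k) (hq : q ∈ harmonicPolynomials m k) (j l : Fin m) :
    sphereIntegral m (MvPolynomial.pderiv j p * (MvPolynomial.X l * q)) =
      ((m : ℝ) + 2 * k - 2)⁻¹ *
        sphereIntegral m (MvPolynomial.pderiv j p * MvPolynomial.pderiv l q) := by
  cases k with
  | zero => simp [pderiv_eq_zero_of_isHomogeneous_zero hp.1]
  | succ k =>
    rw [sphereIntegral_mul_X_mul (by simpa using pderiv_mem_harmonicPolynomials hp j) hq]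
    congr 2
    push_cast
    ring

theorem sphereIntegral_pderiv_pderiv_mul {k : ℕ} {p q : MvPolynomial (Fin m) ℝ}
    (hp : p ∈ harmonicPolynomials m k) (hq : q ∈ harmonicPolynomials m k) (j l : Fin m) :
    sphereIntegral m (MvPolynomial.pderiv l (MvPolynomial.pderiv j p) * q) = 0 := by
  cases k with
  | zero => simp [pderiv_eq_zero_of_isHomogeneous_zero hp.1]
  | succ k =>
    exact sphereIntegral_mul_eq_zero (by omega)
      (pderiv_mem_harmonicPolynomials (pderiv_mem_harmonicPolynomials hp j) l) hq

end HarmonicIdentities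

/-! ### Separation of variables -/

section Separation

variable {m : ℕ}

/-- The space `ℋ_k(ℝ)` as a submodule. -/
def harmonicSubmodule (m k : ℕ) : Submodule ℝ (MvPolynomial (Fin m) ℝ) where
  carrier := harmonicPolynomials m k
  add_mem' hp hq := ⟨hp.1.add hq.1, by
    simp only [map_add, Finset.sum_add_distrib, hp.2, hq.2, add_zero]⟩
  zero_mem' := ⟨MvPolynomial.isHomogeneous_zero _ _ _, by simp⟩
  smul_mem' a _ hp := ⟨(MvPolynomial.homogeneousSubmodule (Fin m) ℝ k).smul_mem a hp.1, by
    simp only [Derivation.map_smul, ← Finset.smul_sum, hp.2, smul_zero]⟩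

instance (k : ℕ) : FiniteDimensional ℝ (harmonicSubmodule m k) :=
  Submodule.finiteDimensional_of_le (S₂ := MvPolynomial.restrictTotalDegree (Fin m) ℝ k)
    fun _ hp => (MvPolynomial.mem_restrictTotalDegree _ _ _).2
      (MvPolynomial.IsHomogeneous.totalDegree_le hp.1)

/-- Evaluation at `u` as a functional on `ℋ_k(ℝ)`. -/
noncomputable def harmonicEval (k : ℕ) (u : EuclideanSpace ℝ (Fin m)) :
    Module.Dual ℝ (harmonicSubmodule m k) where
  toFun p := polyEval u (p : MvPolynomial (Fin m) ℝ)
  map_add' p q := by simp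
  map_smul' a p := by simp [MvPolynomial.smul_eval]

/-- By homogeneity, a polynomial in `ℋ_k(ℝ)` is determined by its values on the unit ball, so the
evaluations at points of the ball span the dual space. -/
theorem span_harmonicEval_eq_top (k : ℕ) :
    Submodule.span ℝ (harmonicEval k '' ball (0 : EuclideanSpace ℝ (Fin m)) 1) = ⊤ := by
  refine Submodule.span_eq_top_of_ne_zero fun p hp => ?_
  have hp0 : (p : MvPolynomial (Fin m) ℝ) ≠ 0 := fun h => hp (Subtype.ext h)
  obtain ⟨x, hx⟩ : ∃ x : Fin m → ℝ, MvPolynomial.eval x (p : MvPolynomial (Fin m) ℝ) ≠ 0 := by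
    by_contra! h
    exact hp0 (MvPolynomial.funext fun x => by rw [h x, map_zero])
  set y : EuclideanSpace ℝ (Fin m) := WithLp.toLp 2 x with hy
  have hr : 0 < (‖y‖ + 1)⁻¹ := by positivity
  refine ⟨_, ⟨(‖y‖ + 1)⁻¹ • y, ?_, rfl⟩, ?_⟩
  · rw [mem_ball_zero_iff, norm_smul, Real.norm_of_nonneg hr.le, ← div_eq_inv_mul,
      div_lt_one (by positivity)]
    linarith
  · change polyEval _ (p : MvPolynomial (Fin m) ℝ) ≠ 0
    rw [MvPolynomial.IsHomogeneous.polyEval_smul p.2.1]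
    exact mul_ne_zero (pow_pos hr k).ne' hx

/-- The coefficients of `f x` in a basis of `ℋ_k(ℝ)` are combinations of values `f x u` at fixed
points `u` of the ball, hence they are `C²` in `x`. -/
theorem IsC2Harmonic.exists_separated {k : ℕ} {Ω : Set (EuclideanSpace ℝ (Fin m))}
    {f : EuclideanSpace ℝ (Fin m) → EuclideanSpace ℝ (Fin m) → ℝ} (hf : IsC2Harmonic Ω k f) :
    ∃ (n : ℕ) (c : Fin n → EuclideanSpace ℝ (Fin m) → ℝ) (p : Fin n → MvPolynomial (Fin m) ℝ),
      (∀ i, ContDiffOn ℝ 2 (c i) (closure Ω)) ∧ (∀ i, p i ∈ harmonicPolynomials m k) ∧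
      ∀ x ∈ closure Ω, ∀ u, f x u = ∑ i, c i x * polyEval u (p i) := by
  classical
  choose! P hPmem hPeq using hf.harmonic
  set Q : EuclideanSpace ℝ (Fin m) → harmonicSubmodule m k := fun x =>
    if hx : x ∈ closure Ω then ⟨P x, hPmem x hx⟩ else 0 with hQ
  have hQP : ∀ x ∈ closure Ω, (Q x : MvPolynomial (Fin m) ℝ) = P x := fun x hx => by
    simp only [hQ, dif_pos hx]
  have hC2 : ∀ φ : Module.Dual ℝ (harmonicSubmodule m k),
      ContDiffOn ℝ 2 (fun x => φ (Q x)) (closure Ω) := by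
    intro φ
    have hφ : φ ∈ Submodule.span ℝ (harmonicEval k '' ball (0 : EuclideanSpace ℝ (Fin m)) 1) := by
      rw [span_harmonicEval_eq_top]; trivial
    induction hφ using Submodule.span_induction with
    | mem φ hφ =>
      obtain ⟨u, hu, rfl⟩ := hφ
      have h1 : ContDiffOn ℝ 2 (fun x => f x u) (closure Ω) :=
        hf.contDiffOn.comp (f := fun x : EuclideanSpace ℝ (Fin m) => (x, u))
          (contDiff_id.prodMk contDiff_const).contDiffOn fun x hx => ⟨hx, hu⟩
      refine h1.congr fun x hx => ?_
      change polyEval u (Q x : MvPolynomial (Fin m) ℝ) = f x u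
      rw [hQP x hx, hPeq x hx]
    | zero => exact contDiffOn_const
    | add φ ψ _ _ h1 h2 => exact h1.add h2
    | smul a φ _ h1 => exact contDiffOn_const.mul h1
  set b := Module.finBasis ℝ (harmonicSubmodule m k)
  refine ⟨_, fun i x => b.coord i (Q x), fun i => b i, fun i => hC2 _, fun i => (b i).2,
    fun x hx u => ?_⟩
  have h1 := congrArg (harmonicEval k u) (b.sum_repr (Q x))
  rw [map_sum] at h1
  have h2 : harmonicEval k u (Q x) = f x u := by
    change polyEval u (Q x : MvPolynomial (Fin m) ℝ) = f x u
    rw [hQP x hx, hPeq x hx]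
  rw [← h2, ← h1]
  exact Finset.sum_congr rfl fun i _ => by rw [map_smul]; rfl

variable {Ω : Set (EuclideanSpace ℝ (Fin m))}

/-- The partial derivative `∂c/∂x_j` of a function of `x`, one-sided on the boundary. -/
noncomputable def coordDeriv (Ω : Set (EuclideanSpace ℝ (Fin m))) (j : Fin m)
    (c : EuclideanSpace ℝ (Fin m) → ℝ) (x : EuclideanSpace ℝ (Fin m)) : ℝ :=
  fderivWithin ℝ c (closure Ω) x (EuclideanSpace.single j 1)

theorem contDiffOn_coordDeriv (hud : UniqueDiffOn ℝ (closure Ω))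
    {c : EuclideanSpace ℝ (Fin m) → ℝ} (hc : ContDiffOn ℝ 2 c (closure Ω)) (j : Fin m) :
    ContDiffOn ℝ 1 (coordDeriv Ω j c) (closure Ω) :=
  (hc.fderivWithin hud (by norm_num)).clm_apply contDiffOn_const

theorem continuousOn_coordDeriv (hud : UniqueDiffOn ℝ (closure Ω))
    {c : EuclideanSpace ℝ (Fin m) → ℝ} (hc : ContDiffOn ℝ 1 c (closure Ω)) (j : Fin m) :
    ContinuousOn (coordDeriv Ω j c) (closure Ω) :=
  (hc.continuousOn_fderivWithin hud le_rfl).clm_apply continuousOn_const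

theorem fderivWithin_eq_sum_coordDeriv (c : EuclideanSpace ℝ (Fin m) → ℝ)
    (x v : EuclideanSpace ℝ (Fin m)) :
    fderivWithin ℝ c (closure Ω) x v = ∑ j, v j * coordDeriv Ω j c x := by
  conv_lhs => rw [← (EuclideanSpace.basisFun (Fin m) ℝ).sum_repr v]
  simp [coordDeriv]

theorem coordDeriv_mul (hud : UniqueDiffOn ℝ (closure Ω)) {b c : EuclideanSpace ℝ (Fin m) → ℝ}
    (hb : ContDiffOn ℝ 1 b (closure Ω)) (hc : ContDiffOn ℝ 1 c (closure Ω)) (j : Fin m)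
    {x : EuclideanSpace ℝ (Fin m)} (hx : x ∈ closure Ω) :
    coordDeriv Ω j (fun x => b x * c x) x = b x * coordDeriv Ω j c x + c x * coordDeriv Ω j b x := by
  unfold coordDeriv
  rw [fderivWithin_fun_mul (hud x hx) (hb.differentiableOn one_ne_zero x hx)
    (hc.differentiableOn one_ne_zero x hx)]
  simp

/-- `F x u = ∑ i, c i x * p i u` for `x` in the set `X`. -/
def IsSeparated {ι : Type*} [Fintype ι] (X : Set (EuclideanSpace ℝ (Fin m)))
    (F : EuclideanSpace ℝ (Fin m) → EuclideanSpace ℝ (Fin m) → ℝ)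
    (c : ι → EuclideanSpace ℝ (Fin m) → ℝ) (p : ι → MvPolynomial (Fin m) ℝ) : Prop :=
  ∀ x ∈ X, ∀ u, F x u = ∑ i, c i x * polyEval u (p i)

namespace IsSeparated

variable {ι : Type*} [Fintype ι] {X : Set (EuclideanSpace ℝ (Fin m))}
  {F : EuclideanSpace ℝ (Fin m) → EuclideanSpace ℝ (Fin m) → ℝ}
  {c : ι → EuclideanSpace ℝ (Fin m) → ℝ} {p : ι → MvPolynomial (Fin m) ℝ}

theorem continuousOn (h : IsSeparated X F c p) (hc : ∀ i, ContinuousOn (c i) X) :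
    ContinuousOn (fun z : EuclideanSpace ℝ (Fin m) × EuclideanSpace ℝ (Fin m) => F z.1 z.2)
      (X ×ˢ Set.univ) := by
  have h1 : ContinuousOn (fun z : EuclideanSpace ℝ (Fin m) × EuclideanSpace ℝ (Fin m) =>
      ∑ i, c i z.1 * polyEval z.2 (p i)) (X ×ˢ Set.univ) := by
    refine continuousOn_finsetSum _ fun i _ => ?_
    exact ((hc i).comp continuousOn_fst fun z hz => hz.1).mul
      ((continuous_polyEval (p i)).comp continuous_snd).continuousOn
  exact h1.congr fun z hz => h z.1 hz.1 z.2

theorem derivX (h : IsSeparated (closure Ω) F c p) (hud : UniqueDiffOn ℝ (closure Ω))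
    (hc : ∀ i, ContDiffOn ℝ 1 (c i) (closure Ω)) {x : EuclideanSpace ℝ (Fin m)}
    (hx : x ∈ closure Ω) (v u : EuclideanSpace ℝ (Fin m)) :
    derivX Ω v F x u = ∑ i, fderivWithin ℝ (c i) (closure Ω) x v * polyEval u (p i) := by
  have hd : ∀ i, DifferentiableWithinAt ℝ (c i) (closure Ω) x := fun i =>
    (hc i).differentiableOn one_ne_zero x hx
  rw [_root_.derivX, fderivWithin_congr (fun y hy => h y hy u) (h x hx u),
    fderivWithin_fun_sum (hud x hx) fun i _ => (hd i).mul_const _, _root_.sum_apply]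
  refine Finset.sum_congr rfl fun i _ => ?_
  rw [fderivWithin_mul_const (hud x hx) (hd i)]
  simp [mul_comm]

theorem partialX (h : IsSeparated (closure Ω) F c p) (hud : UniqueDiffOn ℝ (closure Ω))
    (hc : ∀ i, ContDiffOn ℝ 1 (c i) (closure Ω)) (j : Fin m) :
    IsSeparated (closure Ω) (partialX Ω j F) (fun i => coordDeriv Ω j (c i)) p :=
  fun _ hx u => h.derivX hud hc hx _ u

theorem partialU (h : IsSeparated X F c p) (j : Fin m) :
    IsSeparated X (partialU j F) c (fun i => MvPolynomial.pderiv j (p i)) := by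
  intro x hx u
  have hd : ∀ i, DifferentiableAt ℝ
      (fun u : EuclideanSpace ℝ (Fin m) => polyEval u (p i)) u := fun i =>
    (contDiff_polyEval (p i)).differentiable one_ne_zero u
  rw [_root_.partialU, show F x = fun u => ∑ i, c i x * polyEval u (p i) from funext (h x hx),
    fderiv_fun_sum fun i _ => (hd i).const_mul _, _root_.sum_apply]
  refine Finset.sum_congr rfl fun i _ => ?_
  rw [fderiv_const_mul (hd i), _root_.smul_apply, fderiv_polyEval, smul_eq_mul]

theorem innerDuDx (h : IsSeparated (closure Ω) F c p) (hud : UniqueDiffOn ℝ (closure Ω))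
    (hc : ∀ i, ContDiffOn ℝ 1 (c i) (closure Ω)) :
    IsSeparated (closure Ω) (innerDuDx Ω F) (fun q : Fin m × ι => coordDeriv Ω q.1 (c q.2))
      (fun q => MvPolynomial.pderiv q.1 (p q.2)) := by
  intro x hx u
  rw [_root_.innerDuDx, Fintype.sum_prod_type]
  exact Finset.sum_congr rfl fun j _ => (h.partialX hud hc j).partialU j x hx u

end IsSeparated

end Separation

/-! ### Green's formula -/

section GreenFormula

variable {m : ℕ}

/-- The coefficients of the bilinear form to which `𝒟_k` reduces after integration over the sphere:
`δ_{jl} ∫ p q dS - 4 (m + 2k - 2)⁻² ∫ ∂_j p ∂_l q dS`. -/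
noncomputable def greenForm (k : ℕ) (p q : MvPolynomial (Fin m) ℝ) (j l : Fin m) : ℝ :=
  (if j = l then sphereIntegral m (p * q) else 0) -
    4 * ((m : ℝ) + 2 * k - 2)⁻¹ ^ 2 *
      sphereIntegral m (MvPolynomial.pderiv j p * MvPolynomial.pderiv l q)

theorem greenForm_swap (k : ℕ) (p q : MvPolynomial (Fin m) ℝ) (j l : Fin m) :
    greenForm k q p l j = greenForm k p q j l := by
  unfold greenForm
  rw [mul_comm q p, mul_comm (MvPolynomial.pderiv l q)]
  simp only [eq_comm]

/-- The polynomial `(∑ⱼ a_{jj}) p - 4 (m + 2k - 2)⁻¹ ∑ⱼₗ a_{jl} ∂_j p u_l`. With the second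
derivatives of a coefficient of `f` for `a` this gives the first two terms of `𝒟_k f`, with
`a_{jl} = ∂_j c n_l` it gives `A f`. -/
noncomputable def symbolPolynomial (k : ℕ) (a : Fin m → Fin m → ℝ) (p : MvPolynomial (Fin m) ℝ) :
    MvPolynomial (Fin m) ℝ :=
  (∑ j, a j j) • p - (4 * ((m : ℝ) + 2 * k - 2)⁻¹) •
    ∑ j, ∑ l, a j l • (MvPolynomial.pderiv j p * MvPolynomial.X l)

theorem polyEval_symbolPolynomial (k : ℕ) (a : Fin m → Fin m → ℝ) (p : MvPolynomial (Fin m) ℝ)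
    (u : EuclideanSpace ℝ (Fin m)) :
    polyEval u (symbolPolynomial k a p) = (∑ j, a j j) * polyEval u p -
      4 * ((m : ℝ) + 2 * k - 2)⁻¹ *
        ∑ j, ∑ l, a j l * (polyEval u (MvPolynomial.pderiv j p) * u l) := by
  simp [symbolPolynomial, MvPolynomial.smul_eval]

theorem sphereIntegral_symbolPolynomial_mul {k : ℕ} {p q : MvPolynomial (Fin m) ℝ}
    (hp : p ∈ harmonicPolynomials m k) (hq : q ∈ harmonicPolynomials m k)
    (a : Fin m → Fin m → ℝ) :
    sphereIntegral m (symbolPolynomial k a p * q) = ∑ j, ∑ l, a j l * greenForm k p q j l := by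
  have h : ∀ j l, sphereIntegral m (MvPolynomial.pderiv j p * MvPolynomial.X l * q) =
      ((m : ℝ) + 2 * k - 2)⁻¹ *
        sphereIntegral m (MvPolynomial.pderiv j p * MvPolynomial.pderiv l q) := fun j l => by
    rw [mul_assoc, sphereIntegral_pderiv_mul_X_mul hp hq]
  simp only [symbolPolynomial, sub_mul, smul_mul_assoc, Finset.sum_mul, map_sub, map_smul, map_sum,
    h, greenForm, smul_eq_mul, mul_sub, Finset.sum_sub_distrib, mul_ite, mul_zero,
    Finset.sum_ite_eq, Finset.mem_univ, if_true, Finset.mul_sum]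
  congr 1
  exact Finset.sum_congr rfl fun j _ => Finset.sum_congr rfl fun l _ => by ring

variable {Ω : Set (EuclideanSpace ℝ (Fin m))} {k : ℕ} {ι κ : Type*} [Fintype ι] [Fintype κ]
  {f g : EuclideanSpace ℝ (Fin m) → EuclideanSpace ℝ (Fin m) → ℝ}
  {c : ι → EuclideanSpace ℝ (Fin m) → ℝ} {p : ι → MvPolynomial (Fin m) ℝ}
  {d : κ → EuclideanSpace ℝ (Fin m) → ℝ} {q : κ → MvPolynomial (Fin m) ℝ}

theorem bosonicLaplacian_eq_polyEval (h : IsSeparated (closure Ω) f c p)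
    (hud : UniqueDiffOn ℝ (closure Ω)) (hc : ∀ i, ContDiffOn ℝ 2 (c i) (closure Ω))
    {x : EuclideanSpace ℝ (Fin m)} (hx : x ∈ closure Ω)
    (u : sphere (0 : EuclideanSpace ℝ (Fin m)) 1) :
    bosonicLaplacian Ω k f x u = polyEval (u : EuclideanSpace ℝ (Fin m))
      (∑ i, (symbolPolynomial k (fun j l => coordDeriv Ω l (coordDeriv Ω j (c i)) x) (p i) +
        (4 / (((m : ℝ) + 2 * k - 2) * ((m : ℝ) + 2 * k - 4))) •
          ∑ l, ∑ j, coordDeriv Ω l (coordDeriv Ω j (c i)) x •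
            MvPolynomial.pderiv l (MvPolynomial.pderiv j (p i)))) := by
  have hc1 : ∀ i, ContDiffOn ℝ 1 (c i) (closure Ω) := fun i => (hc i).of_le (by norm_num)
  have hcc : ∀ j i, ContDiffOn ℝ 1 (coordDeriv Ω j (c i)) (closure Ω) := fun j i =>
    contDiffOn_coordDeriv hud (hc i) j
  have hD := h.innerDuDx hud hc1
  have e1 : laplacianX Ω f x u = ∑ i, (∑ j, coordDeriv Ω j (coordDeriv Ω j (c i)) x) *
      polyEval (u : EuclideanSpace ℝ (Fin m)) (p i) := by
    simp only [laplacianX, Finset.sum_mul]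
    rw [Finset.sum_comm]
    exact Finset.sum_congr rfl fun j _ => (h.partialX hud hc1 j).partialX hud (hcc j) j x hx u
  have e2 : innerUDx Ω (innerDuDx Ω f) x u =
      ∑ i, ∑ j, ∑ l, coordDeriv Ω l (coordDeriv Ω j (c i)) x *
        (polyEval (u : EuclideanSpace ℝ (Fin m)) (MvPolynomial.pderiv j (p i)) *
          (u : EuclideanSpace ℝ (Fin m)) l) := by
    have : ∀ l, partialX Ω l (innerDuDx Ω f) x u = _ := fun l =>
      hD.partialX hud (fun r => hcc r.1 r.2) l x hx u
    simp only [innerUDx, this, Fintype.sum_prod_type]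
    simp only [Finset.mul_sum]
    rw [Finset.sum_comm]
    conv_rhs => rw [Finset.sum_comm]
    refine Finset.sum_congr rfl fun j _ => ?_
    rw [Finset.sum_comm]
    exact Finset.sum_congr rfl fun i _ => Finset.sum_congr rfl fun l _ => by ring
  have e3 : innerDuDx Ω (innerDuDx Ω f) x u =
      ∑ i, ∑ l, ∑ j, coordDeriv Ω l (coordDeriv Ω j (c i)) x *
        polyEval (u : EuclideanSpace ℝ (Fin m))
          (MvPolynomial.pderiv l (MvPolynomial.pderiv j (p i))) := by
    rw [hD.innerDuDx hud (fun r => hcc r.1 r.2) x hx u]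
    simp only [Fintype.sum_prod_type, Finset.sum_comm (γ := ι)]
  have hu : ‖(u : EuclideanSpace ℝ (Fin m))‖ = 1 := mem_sphere_zero_iff_norm.1 u.2
  simp only [bosonicLaplacian, e1, e2, e3, hu, map_sum, map_add, polyEval_symbolPolynomial,
    MvPolynomial.smul_eval, Finset.sum_add_distrib, Finset.sum_sub_distrib, ← Finset.mul_sum]
  ring

theorem boundaryOperator_eq_polyEval (h : IsSeparated (closure Ω) f c p)
    (hud : UniqueDiffOn ℝ (closure Ω)) (hc : ∀ i, ContDiffOn ℝ 1 (c i) (closure Ω))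
    {x : EuclideanSpace ℝ (Fin m)} (hx : x ∈ closure Ω) (u : EuclideanSpace ℝ (Fin m)) :
    boundaryOperator Ω k f x u = polyEval u
      (∑ i, symbolPolynomial k (fun j l => coordDeriv Ω j (c i) x * outwardUnitNormal Ω x l)
        (p i)) := by
  have e1 : ⟪u, outwardUnitNormal Ω x⟫_ℝ * innerDuDx Ω f x u =
      ∑ i, ∑ j, ∑ l, coordDeriv Ω j (c i) x * outwardUnitNormal Ω x l *
        (polyEval u (MvPolynomial.pderiv j (p i)) * u l) := by
    rw [h.innerDuDx hud hc x hx u, Fintype.sum_prod_type, Finset.sum_comm, PiLp.inner_apply]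
    simp only [Finset.mul_sum, Finset.sum_mul]
    refine Finset.sum_congr rfl fun i _ => Finset.sum_congr rfl fun j _ =>
      Finset.sum_congr rfl fun l _ => ?_
    simp
    ring
  rw [boundaryOperator, mul_assoc 4, e1]
  simp only [h.derivX hud hc hx, fderivWithin_eq_sum_coordDeriv,
    map_sum, polyEval_symbolPolynomial, Finset.sum_sub_distrib, ← Finset.mul_sum]
  simp only [mul_comm (outwardUnitNormal Ω x _)]
  ring

theorem IsSeparated.eq_polyEval (h : IsSeparated (closure Ω) f c p) {x : EuclideanSpace ℝ (Fin m)}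
    (hx : x ∈ closure Ω) (u : EuclideanSpace ℝ (Fin m)) :
    f x u = polyEval u (∑ i, c i x • p i) := by
  rw [h x hx u]
  simp [MvPolynomial.smul_eval]

/-- Integration over the sphere removes the last term of `𝒟_k f`, which is orthogonal to
`ℋ_k(ℝ)`, and turns the others into the bilinear form `greenForm`. -/
theorem integral_bosonicLaplacian_mul (hf : IsSeparated (closure Ω) f c p)
    (hg : IsSeparated (closure Ω) g d q) (hud : UniqueDiffOn ℝ (closure Ω))
    (hc : ∀ i, ContDiffOn ℝ 2 (c i) (closure Ω)) (hp : ∀ i, p i ∈ harmonicPolynomials m k)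
    (hq : ∀ i, q i ∈ harmonicPolynomials m k) {x : EuclideanSpace ℝ (Fin m)}
    (hx : x ∈ closure Ω) :
    ∫ u : sphere (0 : EuclideanSpace ℝ (Fin m)) 1, bosonicLaplacian Ω k f x u * g x u
      ∂(sphereArea m) = ∑ r : (ι × κ) × Fin m × Fin m, greenForm k (p r.1.1) (q r.1.2) r.2.1 r.2.2 *
        (d r.1.2 x * coordDeriv Ω r.2.2 (coordDeriv Ω r.2.1 (c r.1.1)) x) := by
  simp only [bosonicLaplacian_eq_polyEval hf hud hc hx, hg.eq_polyEval hx, ← map_mul]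
  rw [← sphereIntegral_apply, Finset.sum_mul_sum]
  simp only [map_sum, mul_smul_comm, add_mul, smul_mul_assoc, Finset.sum_mul,
    map_add, map_smul, sphereIntegral_symbolPolynomial_mul (hp _) (hq _),
    sphereIntegral_pderiv_pderiv_mul (hp _) (hq _), mul_zero, Finset.sum_const_zero, add_zero,
    Fintype.sum_prod_type, smul_eq_mul, Finset.mul_sum]
  exact Finset.sum_congr rfl fun i _ => Finset.sum_congr rfl fun i' _ =>
    Finset.sum_congr rfl fun j _ => Finset.sum_congr rfl fun l _ => by ring

theorem integral_boundaryOperator_mul (hf : IsSeparated (closure Ω) f c p)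
    (hg : IsSeparated (closure Ω) g d q) (hud : UniqueDiffOn ℝ (closure Ω))
    (hc : ∀ i, ContDiffOn ℝ 1 (c i) (closure Ω)) (hp : ∀ i, p i ∈ harmonicPolynomials m k)
    (hq : ∀ i, q i ∈ harmonicPolynomials m k) {x : EuclideanSpace ℝ (Fin m)}
    (hx : x ∈ closure Ω) :
    ∫ u : sphere (0 : EuclideanSpace ℝ (Fin m)) 1, boundaryOperator Ω k f x u * g x u
      ∂(sphereArea m) = ∑ r : (ι × κ) × Fin m × Fin m, greenForm k (p r.1.1) (q r.1.2) r.2.1 r.2.2 *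
        (d r.1.2 x * coordDeriv Ω r.2.1 (c r.1.1) x * outwardUnitNormal Ω x r.2.2) := by
  simp only [boundaryOperator_eq_polyEval hf hud hc hx, hg.eq_polyEval hx, ← map_mul]
  rw [← sphereIntegral_apply, Finset.sum_mul_sum]
  simp only [map_sum, mul_smul_comm,
    map_smul, sphereIntegral_symbolPolynomial_mul (hp _) (hq _),
    Fintype.sum_prod_type, smul_eq_mul, Finset.mul_sum]
  exact Finset.sum_congr rfl fun i _ => Finset.sum_congr rfl fun i' _ =>
    Finset.sum_congr rfl fun j _ => Finset.sum_congr rfl fun l _ => by ring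

theorem integrable_bosonicLaplacian_mul (hf : IsSeparated (closure Ω) f c p)
    (hg : IsSeparated (closure Ω) g d q) (hud : UniqueDiffOn ℝ (closure Ω))
    (hc : ∀ i, ContDiffOn ℝ 2 (c i) (closure Ω)) {x : EuclideanSpace ℝ (Fin m)}
    (hx : x ∈ closure Ω) :
    Integrable (fun u : sphere (0 : EuclideanSpace ℝ (Fin m)) 1 =>
      bosonicLaplacian Ω k f x u * g x u) (sphereArea m) := by
  simp only [bosonicLaplacian_eq_polyEval hf hud hc hx, hg.eq_polyEval hx, ← map_mul]
  exact integrable_polyEval_sphere _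

theorem integrable_boundaryOperator_mul (hf : IsSeparated (closure Ω) f c p)
    (hg : IsSeparated (closure Ω) g d q) (hud : UniqueDiffOn ℝ (closure Ω))
    (hc : ∀ i, ContDiffOn ℝ 1 (c i) (closure Ω)) {x : EuclideanSpace ℝ (Fin m)}
    (hx : x ∈ closure Ω) :
    Integrable (fun u : sphere (0 : EuclideanSpace ℝ (Fin m)) 1 =>
      boundaryOperator Ω k f x u * g x u) (sphereArea m) := by
  simp only [boundaryOperator_eq_polyEval hf hud hc hx, hg.eq_polyEval hx, ← map_mul]
  exact integrable_polyEval_sphere _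

theorem continuousOn_bosonicLaplacian (h : IsSeparated (closure Ω) f c p)
    (hud : UniqueDiffOn ℝ (closure Ω)) (hc : ∀ i, ContDiffOn ℝ 2 (c i) (closure Ω)) :
    ContinuousOn (fun z : EuclideanSpace ℝ (Fin m) × EuclideanSpace ℝ (Fin m) =>
      bosonicLaplacian Ω k f z.1 z.2) (closure Ω ×ˢ Set.univ) := by
  have hc1 : ∀ i, ContDiffOn ℝ 1 (c i) (closure Ω) := fun i => (hc i).of_le (by norm_num)
  have hcc : ∀ j i, ContDiffOn ℝ 1 (coordDeriv Ω j (c i)) (closure Ω) := fun j i =>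
    contDiffOn_coordDeriv hud (hc i) j
  have hD := h.innerDuDx hud hc1
  have hDc : ∀ r : Fin m × ι, ContDiffOn ℝ 1 (coordDeriv Ω r.1 (c r.2)) (closure Ω) :=
    fun r => hcc r.1 r.2
  have e1 : ContinuousOn (fun z : EuclideanSpace ℝ (Fin m) × EuclideanSpace ℝ (Fin m) =>
      laplacianX Ω f z.1 z.2) (closure Ω ×ˢ Set.univ) :=
    continuousOn_finsetSum _ fun j _ =>
      ((h.partialX hud hc1 j).partialX hud (hcc j) j).continuousOn fun i =>
        continuousOn_coordDeriv hud (hcc j i) j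
  have e2 : ContinuousOn (fun z : EuclideanSpace ℝ (Fin m) × EuclideanSpace ℝ (Fin m) =>
      innerUDx Ω (innerDuDx Ω f) z.1 z.2) (closure Ω ×ˢ Set.univ) :=
    continuousOn_finsetSum _ fun l _ => ContinuousOn.mul (by fun_prop)
      ((hD.partialX hud hDc l).continuousOn fun r => continuousOn_coordDeriv hud (hDc r) l)
  have e3 : ContinuousOn (fun z : EuclideanSpace ℝ (Fin m) × EuclideanSpace ℝ (Fin m) =>
      innerDuDx Ω (innerDuDx Ω f) z.1 z.2) (closure Ω ×ˢ Set.univ) :=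
    (hD.innerDuDx hud hDc).continuousOn fun r => continuousOn_coordDeriv hud (hDc r.2) r.1
  unfold bosonicLaplacian
  fun_prop

theorem continuousOn_boundaryOperator (h : IsSeparated (closure Ω) f c p)
    (hud : UniqueDiffOn ℝ (closure Ω)) (hc : ∀ i, ContDiffOn ℝ 1 (c i) (closure Ω))
    (hn : ContinuousOn (outwardUnitNormal Ω) (frontier Ω)) :
    ContinuousOn (fun z : EuclideanSpace ℝ (Fin m) × EuclideanSpace ℝ (Fin m) =>
      boundaryOperator Ω k f z.1 z.2) (frontier Ω ×ˢ Set.univ) := by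
  have hn' : ContinuousOn (fun z : EuclideanSpace ℝ (Fin m) × EuclideanSpace ℝ (Fin m) =>
      outwardUnitNormal Ω z.1) (frontier Ω ×ˢ Set.univ) :=
    hn.comp continuousOn_fst fun z hz => hz.1
  have e1 : ContinuousOn (fun z : EuclideanSpace ℝ (Fin m) × EuclideanSpace ℝ (Fin m) =>
      derivX Ω (outwardUnitNormal Ω z.1) f z.1 z.2) (frontier Ω ×ˢ Set.univ) := by
    have hF : IsSeparated (frontier Ω) (fun x u => derivX Ω (outwardUnitNormal Ω x) f x u)
        (fun i x => fderivWithin ℝ (c i) (closure Ω) x (outwardUnitNormal Ω x)) p :=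
      fun x hx u => h.derivX hud hc (frontier_subset_closure hx) _ u
    exact hF.continuousOn fun i =>
      (((hc i).continuousOn_fderivWithin hud le_rfl).mono frontier_subset_closure).clm_apply hn
  have e2 : ContinuousOn (fun z : EuclideanSpace ℝ (Fin m) × EuclideanSpace ℝ (Fin m) =>
      innerDuDx Ω f z.1 z.2) (frontier Ω ×ˢ Set.univ) :=
    ((h.innerDuDx hud hc).continuousOn fun r => continuousOn_coordDeriv hud (hc r.2) r.1).mono
      (Set.prod_mono_left frontier_subset_closure)
  unfold boundaryOperator
  fun_prop

/-- Absolute integrability over `Ω × S^{m-1}` and over `∂Ω × S^{m-1}`, from continuity on a compact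
set that carries the measure. -/
theorem integrable_prod_sphereArea {μ : Measure (EuclideanSpace ℝ (Fin m))} [IsFiniteMeasure μ]
    {K : Set (EuclideanSpace ℝ (Fin m))} (hK : IsCompact K) (hμ : ∀ᵐ x ∂μ, x ∈ K)
    {F : EuclideanSpace ℝ (Fin m) → EuclideanSpace ℝ (Fin m) → ℝ}
    (hF : ContinuousOn (fun z : EuclideanSpace ℝ (Fin m) × EuclideanSpace ℝ (Fin m) => F z.1 z.2)
      (K ×ˢ Set.univ)) :
    Integrable (fun z : EuclideanSpace ℝ (Fin m) × sphere (0 : EuclideanSpace ℝ (Fin m)) 1 =>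
      F z.1 z.2) (μ.prod (sphereArea m)) := by
  have h1 : ContinuousOn
      (fun z : EuclideanSpace ℝ (Fin m) × sphere (0 : EuclideanSpace ℝ (Fin m)) 1 => F z.1 z.2)
      (K ×ˢ Set.univ) :=
    hF.comp (f := fun z : EuclideanSpace ℝ (Fin m) × sphere (0 : EuclideanSpace ℝ (Fin m)) 1 =>
      (z.1, (z.2 : EuclideanSpace ℝ (Fin m)))) (by fun_prop) fun z hz => ⟨hz.1, trivial⟩
  have h2 := h1.integrableOn_compact (μ := μ.prod (sphereArea m)) (hK.prod isCompact_univ)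
  rwa [IntegrableOn, ← Measure.prod_restrict, Measure.restrict_univ,
    Measure.restrict_eq_self_of_ae_mem hμ] at h2

/-- Integration by parts for two functions and two directions. -/
theorem HasC1Boundary.integral_coordDeriv_mul_sub (hΩ1 : HasC1Boundary Ω) (hΩ : IsOpen Ω)
    (hb : Bornology.IsBounded Ω) {b c : EuclideanSpace ℝ (Fin m) → ℝ}
    (hb2 : ContDiffOn ℝ 2 b (closure Ω)) (hc2 : ContDiffOn ℝ 2 c (closure Ω)) (j l : Fin m) :
    ∫ x in Ω, (b x * coordDeriv Ω l (coordDeriv Ω j c) x -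
        c x * coordDeriv Ω j (coordDeriv Ω l b) x) =
      ∫ x, (b x * coordDeriv Ω j c x * outwardUnitNormal Ω x l -
        c x * coordDeriv Ω l b x * outwardUnitNormal Ω x j) ∂(boundaryArea Ω) := by
  have hud := hΩ1.uniqueDiffOn_closure hΩ
  have hb1 : ContDiffOn ℝ 1 b (closure Ω) := hb2.of_le (by norm_num)
  have hc1 : ContDiffOn ℝ 1 c (closure Ω) := hc2.of_le (by norm_num)
  have hbl := contDiffOn_coordDeriv hud hb2 l
  have hcj := contDiffOn_coordDeriv hud hc2 j
  have hK : IsCompact (closure Ω) := hb.isCompact_closure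
  have hn := hΩ1.continuousOn_outwardUnitNormal hΩ
  have key : ∀ (w : EuclideanSpace ℝ (Fin m) → ℝ) (i : Fin m), ContDiffOn ℝ 1 w (closure Ω) →
      Integrable (coordDeriv Ω i w) (volume.restrict Ω) ∧
      Integrable (fun x => w x * outwardUnitNormal Ω x i) (boundaryArea Ω) ∧
      ∫ x in Ω, coordDeriv Ω i w x = ∫ x, w x * outwardUnitNormal Ω x i ∂(boundaryArea Ω) := by
    intro w i hw
    refine ⟨((continuousOn_coordDeriv hud hw i).integrableOn_compact hK).mono_set subset_closure,
      hΩ1.integrable_boundaryArea hΩ hb ((hw.continuousOn.mono frontier_subset_closure).mul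
        (by fun_prop)), ?_⟩
    have h := hΩ1.integral_fderivWithin hΩ hb hw (EuclideanSpace.single i 1)
    simpa [coordDeriv, EuclideanSpace.inner_single_left] using h
  obtain ⟨i1, j1, e1⟩ := key _ l (hb1.mul hcj)
  obtain ⟨i2, j2, e2⟩ := key _ j (hc1.mul hbl)
  rw [integral_sub j1 j2, ← e1, ← e2, ← integral_sub i1 i2]
  refine setIntegral_congr_fun hΩ.measurableSet fun x hx => ?_
  have hx' := subset_closure hx
  rw [coordDeriv_mul hud hb1 hcj l hx', coordDeriv_mul hud hc1 hbl j hx']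
  ring

/-- Both sides are combinations, with coefficients `greenForm`, of the two sides of
`HasC1Boundary.integral_coordDeriv_mul_sub`. -/
theorem HasC1Boundary.integral_bosonicLaplacian_mul_sub (hΩ1 : HasC1Boundary Ω) (hΩ : IsOpen Ω)
    (hb : Bornology.IsBounded Ω) (hf : IsSeparated (closure Ω) f c p)
    (hg : IsSeparated (closure Ω) g d q)
    (hc : ∀ i, ContDiffOn ℝ 2 (c i) (closure Ω)) (hd : ∀ i, ContDiffOn ℝ 2 (d i) (closure Ω))
    (hp : ∀ i, p i ∈ harmonicPolynomials m k)
    (hq : ∀ i, q i ∈ harmonicPolynomials m k) :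
    ∫ x in Ω, ∫ u : sphere (0 : EuclideanSpace ℝ (Fin m)) 1,
        (bosonicLaplacian Ω k f x u * g x u - f x u * bosonicLaplacian Ω k g x u)
          ∂(sphereArea m)
      = ∫ x, ∫ u : sphere (0 : EuclideanSpace ℝ (Fin m)) 1,
        (boundaryOperator Ω k f x u * g x u - f x u * boundaryOperator Ω k g x u)
          ∂(sphereArea m) ∂(boundaryArea Ω) := by
  have hud := hΩ1.uniqueDiffOn_closure hΩ
  have hK : IsCompact (closure Ω) := hb.isCompact_closure
  have hc1 : ∀ i, ContDiffOn ℝ 1 (c i) (closure Ω) := fun i => (hc i).of_le (by norm_num)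
  have hd1 : ∀ i, ContDiffOn ℝ 1 (d i) (closure Ω) := fun i => (hd i).of_le (by norm_num)
  have hn := hΩ1.continuousOn_outwardUnitNormal hΩ
  set σ : (κ × ι) × Fin m × Fin m ≃ (ι × κ) × Fin m × Fin m :=
    (Equiv.prodComm _ _).prodCongr (Equiv.prodComm _ _)
  have hL : ∀ x ∈ Ω, ∫ u : sphere (0 : EuclideanSpace ℝ (Fin m)) 1,
        (bosonicLaplacian Ω k f x u * g x u - f x u * bosonicLaplacian Ω k g x u)
          ∂(sphereArea m) =
      ∑ r : (ι × κ) × Fin m × Fin m, greenForm k (p r.1.1) (q r.1.2) r.2.1 r.2.2 *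
        (d r.1.2 x * coordDeriv Ω r.2.2 (coordDeriv Ω r.2.1 (c r.1.1)) x -
          c r.1.1 x * coordDeriv Ω r.2.1 (coordDeriv Ω r.2.2 (d r.1.2)) x) := by
    intro x hx
    have hx := subset_closure hx
    simp only [mul_comm (f x _)]
    rw [integral_sub (integrable_bosonicLaplacian_mul hf hg hud hc hx)
      (integrable_bosonicLaplacian_mul hg hf hud hd hx),
      integral_bosonicLaplacian_mul hf hg hud hc hp hq hx,
      integral_bosonicLaplacian_mul hg hf hud hd hq hp hx]
    simp only [mul_sub, Finset.sum_sub_distrib]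
    congr 1
    refine Fintype.sum_equiv σ _ _ fun r => ?_
    -- exchanging `f` and `g` exchanges `j` and `l`, under which `greenForm` is symmetric
    rw [greenForm_swap]
    rfl
  have hR : ∀ x ∈ frontier Ω, ∫ u : sphere (0 : EuclideanSpace ℝ (Fin m)) 1,
        (boundaryOperator Ω k f x u * g x u - f x u * boundaryOperator Ω k g x u)
          ∂(sphereArea m) =
      ∑ r : (ι × κ) × Fin m × Fin m, greenForm k (p r.1.1) (q r.1.2) r.2.1 r.2.2 *
        (d r.1.2 x * coordDeriv Ω r.2.1 (c r.1.1) x * outwardUnitNormal Ω x r.2.2 -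
          c r.1.1 x * coordDeriv Ω r.2.2 (d r.1.2) x * outwardUnitNormal Ω x r.2.1) := by
    intro x hx
    have hx := frontier_subset_closure hx
    simp only [mul_comm (f x _)]
    rw [integral_sub (integrable_boundaryOperator_mul hf hg hud hc1 hx)
      (integrable_boundaryOperator_mul hg hf hud hd1 hx),
      integral_boundaryOperator_mul hf hg hud hc1 hp hq hx,
      integral_boundaryOperator_mul hg hf hud hd1 hq hp hx]
    simp only [mul_sub, Finset.sum_sub_distrib]
    congr 1
    refine Fintype.sum_equiv σ _ _ fun r => ?_
    rw [greenForm_swap]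
    rfl
  rw [setIntegral_congr_fun hΩ.measurableSet hL, boundaryArea,
    setIntegral_congr_fun isClosed_frontier.measurableSet hR, ← boundaryArea,
    integral_finsetSum, integral_finsetSum]
  · refine Finset.sum_congr rfl fun r _ => ?_
    rw [integral_const_mul, integral_const_mul,
      hΩ1.integral_coordDeriv_mul_sub hΩ hb (hd _) (hc _)]
  · intro r _
    refine hΩ1.integrable_boundaryArea hΩ hb (continuousOn_const.mul ?_)
    have h1 := (continuousOn_coordDeriv hud (hc1 r.1.1) r.2.1).mono
      (frontier_subset_closure (s := Ω))
    have h2 := (continuousOn_coordDeriv hud (hd1 r.1.2) r.2.2).mono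
      (frontier_subset_closure (s := Ω))
    have h3 := (hc r.1.1).continuousOn.mono (frontier_subset_closure (s := Ω))
    have h4 := (hd r.1.2).continuousOn.mono (frontier_subset_closure (s := Ω))
    fun_prop
  · intro r _
    refine ((continuousOn_const.mul ?_).integrableOn_compact hK).mono_set subset_closure
    have h1 := continuousOn_coordDeriv hud (contDiffOn_coordDeriv hud (hc r.1.1) r.2.1) r.2.2
    have h2 := continuousOn_coordDeriv hud (contDiffOn_coordDeriv hud (hd r.1.2) r.2.2) r.2.1
    have h3 := (hc r.1.1).continuousOn
    have h4 := (hd r.1.2).continuousOn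
    fun_prop

end GreenFormula
theorem mainTheorem2 (m k : ℕ) (Ω : Set (EuclideanSpace ℝ (Fin m)))
    (hΩ : IsOpen Ω) (hΩb : Bornology.IsBounded Ω) (hΩ1 : HasC1Boundary Ω) :
    (∀ f g : EuclideanSpace ℝ (Fin m) → EuclideanSpace ℝ (Fin m) → ℝ,
      IsC2Harmonic Ω k f → IsC2Harmonic Ω k g →
        Integrable
          (fun z : EuclideanSpace ℝ (Fin m) × sphere (0 : EuclideanSpace ℝ (Fin m)) 1 =>
            bosonicLaplacian Ω k f z.1 z.2 * g z.1 z.2)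
          ((volume.restrict Ω).prod (sphereArea m)) ∧
        Integrable
          (fun z : EuclideanSpace ℝ (Fin m) × sphere (0 : EuclideanSpace ℝ (Fin m)) 1 =>
            f z.1 z.2 * bosonicLaplacian Ω k g z.1 z.2)
          ((volume.restrict Ω).prod (sphereArea m)) ∧
        Integrable
          (fun z : EuclideanSpace ℝ (Fin m) × sphere (0 : EuclideanSpace ℝ (Fin m)) 1 =>
            boundaryOperator Ω k f z.1 z.2 * g z.1 z.2)
          ((boundaryArea Ω).prod (sphereArea m)) ∧
        Integrable
          (fun z : EuclideanSpace ℝ (Fin m) × sphere (0 : EuclideanSpace ℝ (Fin m)) 1 =>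
            f z.1 z.2 * boundaryOperator Ω k g z.1 z.2)
          ((boundaryArea Ω).prod (sphereArea m)) ∧
        ∫ x in Ω, ∫ u : sphere (0 : EuclideanSpace ℝ (Fin m)) 1,
            (bosonicLaplacian Ω k f x u * g x u - f x u * bosonicLaplacian Ω k g x u)
              ∂(sphereArea m)
          = ∫ x, ∫ u : sphere (0 : EuclideanSpace ℝ (Fin m)) 1,
            (boundaryOperator Ω k f x u * g x u - f x u * boundaryOperator Ω k g x u)
              ∂(sphereArea m) ∂(boundaryArea Ω)) ∧
    (∀ f g : EuclideanSpace ℝ (Fin m) → EuclideanSpace ℝ (Fin m) → ℝ,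
      IsC2Harmonic Ω k f → IsC2Harmonic Ω k g →
      (∀ x ∈ frontier Ω, ∀ u ∈ sphere (0 : EuclideanSpace ℝ (Fin m)) 1, f x u = 0) →
      (∀ x ∈ frontier Ω, ∀ u ∈ sphere (0 : EuclideanSpace ℝ (Fin m)) 1, g x u = 0) →
        pairing Ω (bosonicLaplacian Ω k f) g = pairing Ω f (bosonicLaplacian Ω k g)) := by
  have green : ∀ f g : EuclideanSpace ℝ (Fin m) → EuclideanSpace ℝ (Fin m) → ℝ,
      IsC2Harmonic Ω k f → IsC2Harmonic Ω k g →
        Integrable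
          (fun z : EuclideanSpace ℝ (Fin m) × sphere (0 : EuclideanSpace ℝ (Fin m)) 1 =>
            bosonicLaplacian Ω k f z.1 z.2 * g z.1 z.2)
          ((volume.restrict Ω).prod (sphereArea m)) ∧
        Integrable
          (fun z : EuclideanSpace ℝ (Fin m) × sphere (0 : EuclideanSpace ℝ (Fin m)) 1 =>
            boundaryOperator Ω k f z.1 z.2 * g z.1 z.2)
          ((boundaryArea Ω).prod (sphereArea m)) ∧
        (∀ x ∈ Ω, Integrable (fun u : sphere (0 : EuclideanSpace ℝ (Fin m)) 1 =>
          bosonicLaplacian Ω k f x u * g x u) (sphereArea m)) ∧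
        ∫ x in Ω, ∫ u : sphere (0 : EuclideanSpace ℝ (Fin m)) 1,
            (bosonicLaplacian Ω k f x u * g x u - f x u * bosonicLaplacian Ω k g x u)
              ∂(sphereArea m)
          = ∫ x, ∫ u : sphere (0 : EuclideanSpace ℝ (Fin m)) 1,
            (boundaryOperator Ω k f x u * g x u - f x u * boundaryOperator Ω k g x u)
              ∂(sphereArea m) ∂(boundaryArea Ω) := by
    intro f g hf hg
    obtain ⟨_, c, p, hc, hp, hfs⟩ := hf.exists_separated
    obtain ⟨_, d, q, hd, hq, hgs⟩ := hg.exists_separated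
    have hfs : IsSeparated (closure Ω) f c p := hfs
    have hgs : IsSeparated (closure Ω) g d q := hgs
    have hud := hΩ1.uniqueDiffOn_closure hΩ
    have hK : IsCompact (closure Ω) := hΩb.isCompact_closure
    have hgc := hgs.continuousOn fun i => (hd i).continuousOn
    have : IsFiniteMeasure (volume.restrict Ω) :=
      isFiniteMeasure_restrict.2 hΩb.measure_lt_top.ne
    have := hΩ1.isFiniteMeasure_boundaryArea hΩ hΩb
    refine ⟨?_, ?_, fun x hx => integrable_bosonicLaplacian_mul hfs hgs hud hc (subset_closure hx),
      hΩ1.integral_bosonicLaplacian_mul_sub hΩ hΩb hfs hgs hc hd hp hq⟩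
    · refine integrable_prod_sphereArea (F := fun x u => bosonicLaplacian Ω k f x u * g x u) hK ?_
        ((continuousOn_bosonicLaplacian hfs hud hc).mul hgc)
      filter_upwards [ae_restrict_mem hΩ.measurableSet] with x hx using subset_closure hx
    · refine integrable_prod_sphereArea (μ := boundaryArea Ω)
        (F := fun x u => boundaryOperator Ω k f x u * g x u)
        (hK.of_isClosed_subset isClosed_frontier frontier_subset_closure)
        (ae_restrict_mem isClosed_frontier.measurableSet)
        ((continuousOn_boundaryOperator hfs hud (fun i => (hc i).of_le (by norm_num))
          (hΩ1.continuousOn_outwardUnitNormal hΩ)).mul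
          (hgc.mono (Set.prod_mono_left frontier_subset_closure)))
  refine ⟨fun f g hf hg => ?_, fun f g hf hg hf0 hg0 => ?_⟩
  · obtain ⟨i1, i2, -, h⟩ := green f g hf hg
    obtain ⟨i3, i4, -, -⟩ := green g f hg hf
    exact ⟨i1, i3.congr (ae_of_all _ fun z => mul_comm _ _), i2,
      i4.congr (ae_of_all _ fun z => mul_comm _ _), h⟩
  · obtain ⟨i1, -, j1, h⟩ := green f g hf hg
    obtain ⟨i2, -, j2, -⟩ := green g f hg hf
    have h0 : ∫ x, ∫ u : sphere (0 : EuclideanSpace ℝ (Fin m)) 1,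
        (boundaryOperator Ω k f x u * g x u - f x u * boundaryOperator Ω k g x u)
          ∂(sphereArea m) ∂(boundaryArea Ω) = 0 := by
      rw [boundaryArea, setIntegral_congr_fun (g := fun _ => (0 : ℝ))
        isClosed_frontier.measurableSet fun x hx => ?_, integral_zero]
      have hfx : ∀ u : sphere (0 : EuclideanSpace ℝ (Fin m)) 1, f x u = 0 := fun u =>
        hf0 x hx u u.2
      have hgx : ∀ u : sphere (0 : EuclideanSpace ℝ (Fin m)) 1, g x u = 0 := fun u =>
        hg0 x hx u u.2
      simp [hfx, hgx]
    rw [h0, setIntegral_congr_fun hΩ.measurableSet fun x hx => integral_sub (j1 x hx)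
      ((j2 x hx).congr (ae_of_all _ fun u => mul_comm _ _)), integral_sub i1.integral_prod_left
        (i2.congr (ae_of_all _ fun u => mul_comm _ _)).integral_prod_left] at h
    exact sub_eq_zero.1 h
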